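/- Let $n_x\ge 0$, $n_u\ge 1$ and $i\in\{1,\dots,n_u\}$, let $B_0\in\mathbb R^{n_x\times n_u}$ with $i$-th column $[B_0]_i$ and $B_i\in\mathbb R^{n_x\times n_x}$ be unknown, and consider the affine system $$\mathcal S_i:\quad x_t^+=[B_0]_i+B_ix_t+w_t ,\qquad t=1,\dots,T_i .$$ Let $x_1,\dots,x_{T_i}$ be i.i.d. random vectors in $\mathbb R^{n_x}$ (with any distribution), let $w_1,\dots,w_{T_i}$ be i.i.d. with $w_t\sim\mathcal N(0,\sigma_w^2I_{n_x})$, $\sigma_w\ge 0$, and let $(w_t)_t$ be independent of $(x_t)_t$. Let $[\hat B_i\ \ [\hat B_0]_i]$ be an ordinary least-squares estimate, i.e. any minimiser over $\theta\in\mathbb R^{n_x\times(n_x+1)}$ of $\sum_{t=1}^{T_i}\bigl\|x_t^+-\theta\begin{bmatrix}x_t\\1\end{bmatrix}\bigr\|_2^2$. For a scale $\sigma_x>0$ put $\xi_t=x_t/\sigma_x$ and $$M_i=\begin{bmatrix}\sum_{t}\xi_t\xi_t^\top&\sum_t\xi_t\\ \sum_t\xi_t^\top&T_i\end{bmatrix},\qquad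 E=\begin{bmatrix}\sigma_x(\hat B_i-B_i)^\top\\([\hat B_0]_i-[B_0]_i)^\top\end{bmatrix}.$$ Fix $\delta\in(0,1)$, assume $T_i\ge n_x+1$, and define $$C_1(n_x,\delta)=\sigma_w^2\Bigl(\sqrt{n_x+1}+\sqrt{n_x}+\sqrt{2\log(2n_u/\delta)}\Bigr)^2 .$$ Then with probability at least $1-\frac{\delta}{2n_u}$ every such least-squares estimate satisfies $$E\,E^\top\preceq C_1(n_x,\delta)\,M_i^{-1}.$$ Here, if $M_i$ has zero as an eigenvalue, the inverse of that eigenvalue is defined to be $\infty$: with eigenvalues $\lambda_j$ and orthonormal eigenvectors $q_j$ of $M_i$, the inequality means $v^\top EE^\top v\le C_1(n_x,\delta)\sum_j\lambda_j^{-1}(q_j^\top v)^2$ for all $v\in\mathbb R^{n_x+1}$, with $0^{-1}=\infty$, $\infty\cdot 0=0$ inside the sum, and no constraint on $v$ when the sum is infinite. In particular, for $\sigma_x=1$ one has $M_i=\sum_t\begin{bmatrix}x_t\\1\end{bmatrix}\begin{bmatrix}x_t\\1\end{bmatrix}^\top$ and $E=\begin{bmatrix}\hat B_i-B_i&[\hat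 B_0]_i-[B_0]_i\end{bmatrix}^\top$. -/

import Mathlib

open MeasureTheory ProbabilityTheory
open scoped ENNReal Matrix

noncomputable section

namespace BilinearId

/-- One step of the affine subsystem `x⁺ = b + B x + w`. -/
def affineStep {nx : ℕ} (B : Matrix (Fin nx) (Fin nx) ℝ) (b : Fin nx → ℝ)
    (x w : EuclideanSpace ℝ (Fin nx)) : EuclideanSpace ℝ (Fin nx) :=
  WithLp.toLp 2 (b + B *ᵥ x.ofLp) + w

/-- The parameter matrix `θ = [B  b]`. -/
def param {nx : ℕ} (B : Matrix (Fin nx) (Fin nx) ℝ) (b : Fin nx → ℝ) :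
    Matrix (Fin nx) (Fin nx ⊕ Unit) ℝ :=
  Matrix.fromCols B (Matrix.replicateCol Unit b)

/-- The regressor `y = (x, 1)`. -/
def regressor {nx : ℕ} (x : EuclideanSpace ℝ (Fin nx)) : Fin nx ⊕ Unit → ℝ :=
  Sum.elim x.ofLp (fun _ => 1)

/-- The least-squares cost `∑ₜ ‖xₜ⁺ - θ yₜ‖²`. -/
def lsCost {nx T : ℕ} (x xplus : Fin T → EuclideanSpace ℝ (Fin nx))
    (θ : Matrix (Fin nx) (Fin nx ⊕ Unit) ℝ) : ℝ :=
  ∑ t, ‖xplus t - WithLp.toLp 2 (θ *ᵥ regressor (x t))‖ ^ 2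

/-- `θ` is an ordinary least-squares estimate: a minimiser of the least-squares cost. -/
def IsOLS {nx T : ℕ} (x xplus : Fin T → EuclideanSpace ℝ (Fin nx))
    (θ : Matrix (Fin nx) (Fin nx ⊕ Unit) ℝ) : Prop :=
  ∀ θ', lsCost x xplus θ ≤ lsCost x xplus θ'

/-- The data matrix `M = [∑ ξₜ ξₜᵀ, ∑ ξₜ; ∑ ξₜᵀ, T]`, where `ξₜ = xₜ / σx`. -/
def dataMatrix {nx T : ℕ} (σx : ℝ) (x : Fin T → EuclideanSpace ℝ (Fin nx)) :
    Matrix (Fin nx ⊕ Unit) (Fin nx ⊕ Unit) ℝ :=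
  let ξ : Fin T → Fin nx → ℝ := fun t => σx⁻¹ • (x t).ofLp
  Matrix.fromBlocks
    (∑ t, Matrix.vecMulVec (ξ t) (ξ t))
    (Matrix.replicateCol Unit (∑ t, ξ t))
    (Matrix.replicateRow Unit (∑ t, ξ t))
    (Matrix.of fun _ _ => (T : ℝ))

theorem dataMatrix_isHermitian {nx T : ℕ} (σx : ℝ) (x : Fin T → EuclideanSpace ℝ (Fin nx)) :
    (dataMatrix σx x).IsHermitian := by
  ext i j
  rcases i with i | i <;> rcases j with j | j <;>
    simp [dataMatrix, Matrix.sum_apply, Matrix.vecMulVec_apply, mul_comm]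

/-- The stacked error `[σx (B̂ - B)ᵀ ; (b̂ - b)ᵀ]`, i.e. the transposed parameter error with the
state block expressed in the units of `ξ = x / σx`. For `σx = 1` it is `(θ̂ - θ)ᵀ`. -/
def stackedError {nx : ℕ} (σx : ℝ) (θhat θ : Matrix (Fin nx) (Fin nx ⊕ Unit) ℝ) :
    Matrix (Fin nx ⊕ Unit) (Fin nx) ℝ :=
  Matrix.diagonal (Sum.elim (fun _ => σx) (fun _ => 1)) * (θhat - θ)ᵀ

/-- The quadratic form `v ↦ vᵀ M⁻¹ v = ∑ⱼ λⱼ⁻¹ ⟨qⱼ, v⟩²` of the inverse of a positive semidefinite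
matrix `M` with eigenvalues `λⱼ` and orthonormal eigenvectors `qⱼ`, where the inverse of a zero
eigenvalue is `∞` (and `∞ * 0 = 0`). -/
def invQuadForm {n : Type} [Fintype n] [DecidableEq n] {M : Matrix n n ℝ}
    (hM : M.IsHermitian) (v : n → ℝ) : ℝ≥0∞ :=
  ∑ j, (ENNReal.ofReal (hM.eigenvalues j))⁻¹ *
    ENNReal.ofReal (((hM.eigenvectorBasis j).ofLp ⬝ᵥ v) ^ 2)

/-- The Loewner inequality `P ⪯ c M⁻¹`, where zero eigenvalues of `M` have inverse `∞`: in the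
directions `v` with `vᵀ M⁻¹ v = ∞` the right-hand side is infinite (for `c = 0` as well). -/
def LoewnerLEInv {n : Type} [Fintype n] [DecidableEq n] (P : Matrix n n ℝ) (c : ℝ)
    {M : Matrix n n ℝ} (hM : M.IsHermitian) : Prop :=
  ∀ v : n → ℝ, invQuadForm hM v ≠ ∞ →
    ENNReal.ofReal (v ⬝ᵥ (P *ᵥ v)) ≤ ENNReal.ofReal c * invQuadForm hM v

theorem invQuadForm_of_posDef {n : Type} [Fintype n] [DecidableEq n] {M : Matrix n n ℝ}
    (hM : M.PosDef) (v : n → ℝ) :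
    invQuadForm hM.isHermitian v = ENNReal.ofReal (v ⬝ᵥ (M⁻¹ *ᵥ v)) := by
  set b := hM.isHermitian.eigenvectorBasis with hb
  have hinv : ∀ j, M⁻¹ *ᵥ (b j).ofLp = (hM.isHermitian.eigenvalues j)⁻¹ • (b j).ofLp := by
    intro j
    have h1 := hM.isHermitian.mulVec_eigenvectorBasis j
    have hpos := hM.eigenvalues_pos j
    have h2 : M⁻¹ *ᵥ (M *ᵥ (b j).ofLp) = (b j).ofLp := by
      rw [Matrix.mulVec_mulVec, Matrix.nonsing_inv_mul _ ((Matrix.isUnit_iff_isUnit_det M).1 hM.isUnit),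
        Matrix.one_mulVec]
    rw [h1, Matrix.mulVec_smul] at h2
    rw [eq_inv_smul_iff₀ hpos.ne']
    exact h2
  have hv : v = ∑ j, ((b j).ofLp ⬝ᵥ v) • (b j).ofLp := by
    have := congrArg WithLp.ofLp (b.sum_repr' (WithLp.toLp 2 v))
    simp only [WithLp.ofLp_sum, WithLp.ofLp_smul,
      EuclideanSpace.inner_eq_star_dotProduct, star_trivial] at this
    conv_lhs => rw [← this]
    exact Finset.sum_congr rfl fun j _ => by rw [dotProduct_comm]
  have hq : v ⬝ᵥ (M⁻¹ *ᵥ v) =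
      ∑ j, (hM.isHermitian.eigenvalues j)⁻¹ * ((b j).ofLp ⬝ᵥ v) ^ 2 := by
    have hMv : M⁻¹ *ᵥ v = ∑ j, ((b j).ofLp ⬝ᵥ v) • M⁻¹ *ᵥ (b j).ofLp := by
      conv_lhs => rw [hv]
      rw [Matrix.mulVec_sum]
      simp [Matrix.mulVec_smul]
    rw [hMv, dotProduct_sum]
    refine Finset.sum_congr rfl fun j _ => ?_
    rw [hinv, dotProduct_smul, dotProduct_smul, dotProduct_comm v]
    simp only [smul_eq_mul]
    ring
  rw [hq, invQuadForm, ENNReal.ofReal_sum_of_nonneg]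
  · refine Finset.sum_congr rfl fun j _ => ?_
    have hpos := hM.eigenvalues_pos j
    rw [ENNReal.ofReal_mul (inv_nonneg.2 hpos.le), ENNReal.ofReal_inv_of_pos hpos]
  · intro j _
    have hpos := hM.eigenvalues_pos j
    positivity

/-- For positive definite `M` the inequality is the usual Loewner inequality. -/
theorem loewnerLEInv_iff_of_posDef {n : Type} [Fintype n] [DecidableEq n] {P M : Matrix n n ℝ}
    (hP : P.PosSemidef) {c : ℝ} (hc : 0 ≤ c) (hM : M.PosDef) :
    LoewnerLEInv P c hM.isHermitian ↔ (c • M⁻¹ - P).PosSemidef := by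
  have hH : (c • M⁻¹ - P).IsHermitian := by
    have h1 := hM.isHermitian.inv
    have h2 := hP.isHermitian
    unfold Matrix.IsHermitian at *
    rw [Matrix.conjTranspose_sub, Matrix.conjTranspose_smul, h1, h2]
    simp
  rw [Matrix.posSemidef_iff_dotProduct_mulVec]
  simp only [hH, true_and, LoewnerLEInv, invQuadForm_of_posDef hM, star_trivial,
    ne_eq, ENNReal.ofReal_ne_top, not_false_eq_true, true_imp_iff]
  refine forall_congr' fun v => ?_
  have h0 : 0 ≤ v ⬝ᵥ (M⁻¹ *ᵥ v) := by
    simpa using hM.inv.posSemidef.dotProduct_mulVec_nonneg v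
  rw [← ENNReal.ofReal_mul hc, ENNReal.ofReal_le_ofReal_iff (mul_nonneg hc h0),
    Matrix.sub_mulVec, dotProduct_sub, Matrix.smul_mulVec, dotProduct_smul, smul_eq_mul,
    sub_nonneg]

/-- `C₁ = σw² (√(nx+1) + √nx + √(2 log(2 nu / δ)))²`. -/
def C₁ (σw : ℝ) (nx nu : ℕ) (δ : ℝ) : ℝ :=
  σw ^ 2 * (√((nx : ℝ) + 1) + √(nx : ℝ) + √(2 * Real.log (2 * (nu : ℝ) / δ))) ^ 2

end BilinearId

end

/-!
The least-squares error is governed by the noise `W = (w₁, …, w_T)` through the bilinear form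
`(z, v) ↦ ∑ₜ zₜ ⟨v, wₜ⟩`, where `z` runs through the column space of the regressors, a space of
dimension at most `nx + 1`. For standard Gaussian noise and unit vectors `z`, `v` this is a Gaussian
process whose increments are dominated by those of `(z, v) ↦ ⟨g, z⟩ + ⟨h, v⟩` with independent
standard Gaussian `g`, `h`. Slepian's comparison, proved by interpolating between the two processes,
bounds the exponential moments of its supremum (Chevet's inequality), and Markov's inequality shows
that the form has norm at most `√(nx + 1) + √nx + s` with probability at least `1 - exp (-s² / 2)`,
conditionally on the regressors. By the normal equations, on that event every vector `M u` in the
range of the data matrix satisfies `‖Eᵀ M u‖² ≤ κ² uᵀ M u`, where `κ = σw (√(nx + 1) + √nx + s)`;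
this is the claim, since `vᵀ M⁻¹ v` is infinite off the range of `M`.
-/

namespace BilinearId

/-! ### The density of the standard Gaussian measure -/

section Density

variable {E : Type*} [NormedAddCommGroup E] [InnerProductSpace ℝ E]

/-- The Lebesgue density `(2π)^(-d/2) exp(-‖x‖²/2)` of the standard Gaussian measure on a
`d`-dimensional Euclidean space. -/
noncomputable def stdGaussianPDFReal (x : E) : ℝ :=
  (2 * Real.pi) ^ (-(Module.finrank ℝ E / 2 : ℝ)) * Real.exp (-(1 / 2) * ‖x‖ ^ 2)

lemma stdGaussianPDFReal_nonneg (x : E) : 0 ≤ stdGaussianPDFReal x := by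
  unfold stdGaussianPDFReal; positivity

lemma stdGaussianPDFReal_mul_exp_mul_sq_norm (a : ℝ) (x : E) :
    stdGaussianPDFReal x * Real.exp (a * ‖x‖ ^ 2) =
      (2 * Real.pi) ^ (-(Module.finrank ℝ E / 2 : ℝ)) * Real.exp (-(1 / 2 - a) * ‖x‖ ^ 2) := by
  rw [stdGaussianPDFReal, mul_assoc, ← Real.exp_add]
  ring_nf

lemma hasFDerivAt_stdGaussianPDFReal (x : E) :
    HasFDerivAt stdGaussianPDFReal (-stdGaussianPDFReal x • innerSL ℝ x) x := by
  have h := (((hasStrictFDerivAt_norm_sq x).hasFDerivAt.const_mul (-(1 / 2 : ℝ))).exp).const_mul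
    ((2 * Real.pi) ^ (-(Module.finrank ℝ E / 2 : ℝ)))
  refine h.congr_fderiv ?_
  ext y
  simp only [stdGaussianPDFReal, smul_apply, coe_innerSL_apply, nsmul_eq_mul, smul_eq_mul]
  push_cast
  ring

variable [MeasurableSpace E] [BorelSpace E]

@[fun_prop]
lemma measurable_stdGaussianPDFReal : Measurable (stdGaussianPDFReal : E → ℝ) := by
  unfold stdGaussianPDFReal; fun_prop

variable [FiniteDimensional ℝ E]

lemma integrable_exp_neg_mul_sq_norm {b : ℝ} (hb : 0 < b) :
    Integrable fun x : E => Real.exp (-b * ‖x‖ ^ 2) := by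
  refine Integrable.of_integral_ne_zero ?_
  rw [GaussianFourier.integral_rexp_neg_mul_sq_norm hb]
  positivity

lemma integrable_stdGaussianPDFReal : Integrable (stdGaussianPDFReal : E → ℝ) :=
  (integrable_exp_neg_mul_sq_norm one_half_pos).const_mul _

lemma integral_cexp_inner_mul_stdGaussianPDFReal (t : E) :
    ∫ x : E, stdGaussianPDFReal x • Complex.exp ((inner ℝ x t : ℝ) * Complex.I) =
      Complex.exp (-(‖t‖ ^ 2 : ℝ) / 2) := by
  have integrand_eq : ∀ x : E,
      stdGaussianPDFReal x • Complex.exp ((inner ℝ x t : ℝ) * Complex.I) =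
      (((2 * Real.pi) ^ (-(Module.finrank ℝ E / 2 : ℝ)) : ℝ) : ℂ) *
        Complex.exp (-(1 / 2 : ℂ) * (‖x‖ : ℂ) ^ 2 + Complex.I * ((inner ℝ t x : ℝ) : ℂ)) := by
    intro x
    rw [stdGaussianPDFReal, Complex.real_smul, Complex.exp_add, real_inner_comm]
    push_cast
    ring_nf
  have normalization : (((2 * Real.pi) ^ (-(Module.finrank ℝ E / 2 : ℝ)) : ℝ) : ℂ) *
      ((Real.pi : ℂ) / (1 / 2)) ^ ((Module.finrank ℝ E : ℂ) / 2) = 1 := by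
    rw [show (Real.pi : ℂ) / (1 / 2) = ((2 * Real.pi : ℝ) : ℂ) by push_cast; ring,
      show (Module.finrank ℝ E : ℂ) / 2 = ((Module.finrank ℝ E / 2 : ℝ) : ℂ) by push_cast; rfl,
      ← Complex.ofReal_cpow (by positivity), ← Complex.ofReal_mul,
      ← Real.rpow_add (by positivity), neg_add_cancel, Real.rpow_zero, Complex.ofReal_one]
  simp_rw [integrand_eq]
  rw [integral_const_mul,
    GaussianFourier.integral_cexp_neg_mul_sq_norm_add (b := (1 / 2 : ℂ)) (by norm_num) Complex.I t,
    Complex.I_sq, ← mul_assoc, normalization, one_mul]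
  push_cast
  ring_nf

theorem stdGaussian_eq_withDensity :
    stdGaussian E = volume.withDensity fun x => ENNReal.ofReal (stdGaussianPDFReal x) := by
  have : IsFiniteMeasure ((volume : Measure E).withDensity
      fun x => ENNReal.ofReal (stdGaussianPDFReal x)) :=
    isFiniteMeasure_withDensity_ofReal integrable_stdGaussianPDFReal.2
  refine Measure.ext_of_charFun (funext fun t => ?_)
  rw [charFun_stdGaussian, charFun_apply, integral_withDensity_eq_integral_toReal_smul
    (by fun_prop) (ae_of_all _ fun x => ENNReal.ofReal_lt_top)]
  simp_rw [ENNReal.toReal_ofReal (stdGaussianPDFReal_nonneg _)]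
  rw [integral_cexp_inner_mul_stdGaussianPDFReal]
  push_cast
  ring_nf

variable {F : Type*} [NormedAddCommGroup F] [NormedSpace ℝ F]

lemma integral_stdGaussian (f : E → F) :
    ∫ x, f x ∂stdGaussian E = ∫ x, stdGaussianPDFReal x • f x := by
  rw [stdGaussian_eq_withDensity, integral_withDensity_eq_integral_toReal_smul (by fun_prop)
    (ae_of_all _ fun x => ENNReal.ofReal_lt_top)]
  simp_rw [ENNReal.toReal_ofReal (stdGaussianPDFReal_nonneg _)]

lemma integrable_stdGaussian_iff (f : E → F) :
    Integrable f (stdGaussian E) ↔ Integrable fun x => stdGaussianPDFReal x • f x := by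
  rw [stdGaussian_eq_withDensity, integrable_withDensity_iff_integrable_smul' (by fun_prop)
    (ae_of_all _ fun x => ENNReal.ofReal_lt_top)]
  simp_rw [ENNReal.toReal_ofReal (stdGaussianPDFReal_nonneg _)]

theorem integral_inner_mul_stdGaussian {f : E → ℝ} {f' : E → E →L[ℝ] ℝ}
    (hf : ∀ x, HasFDerivAt f (f' x) x) (a : E) (hfi : Integrable f (stdGaussian E))
    (hf'i : Integrable (fun x => f' x a) (stdGaussian E))
    (haf : Integrable (fun x => inner ℝ a x * f x) (stdGaussian E)) :
    ∫ x, inner ℝ a x * f x ∂stdGaussian E = ∫ x, f' x a ∂stdGaussian E := by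
  rw [integrable_stdGaussian_iff] at hfi hf'i haf
  simp only [smul_eq_mul] at hfi hf'i haf
  have fderiv_pdf : ∀ x : E,
      fderiv ℝ (stdGaussianPDFReal : E → ℝ) x a = -(stdGaussianPDFReal x * inner ℝ a x) :=
    fun x => by simp [(hasFDerivAt_stdGaussianPDFReal x).fderiv, real_inner_comm]
  have fderiv_f : ∀ x, fderiv ℝ f x a = f' x a := fun x => by rw [(hf x).fderiv]
  have parts := integral_mul_fderiv_eq_neg_fderiv_mul_of_integrable (𝕜 := ℝ)
    (μ := (volume : Measure E)) (f := stdGaussianPDFReal) (g := f) (v := a)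
    (by simpa only [fderiv_pdf, neg_mul, mul_assoc] using haf.fun_neg)
    (by simpa only [fderiv_f] using hf'i) hfi
    (fun x _ => (hasFDerivAt_stdGaussianPDFReal x).differentiableAt)
    (fun x _ => (hf x).differentiableAt)
  simp only [fderiv_f, fderiv_pdf, neg_mul, integral_neg, neg_neg] at parts
  simp only [integral_stdGaussian, smul_eq_mul, parts, mul_assoc]

end Density

/-! ### Exponential moments of the norm -/

section NormMoments

lemma mul_le_sq_div_add_mul_sq {a : ℝ} (ha : 0 < a) (l t : ℝ) :
    l * t ≤ l ^ 2 / (4 * a) + a * t ^ 2 := by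
  have square : l ^ 2 / (4 * a) + a * t ^ 2 - l * t = (l - 2 * a * t) ^ 2 / (4 * a) := by
    field_simp; ring
  linarith [show 0 ≤ (l - 2 * a * t) ^ 2 / (4 * a) by positivity]

variable (E : Type*) [NormedAddCommGroup E] [InnerProductSpace ℝ E] [FiniteDimensional ℝ E]
  [MeasurableSpace E] [BorelSpace E]

lemma integrable_exp_mul_sq_norm_stdGaussian {a : ℝ} (ha : a < 1 / 2) :
    Integrable (fun x : E => Real.exp (a * ‖x‖ ^ 2)) (stdGaussian E) := by
  simp only [integrable_stdGaussian_iff, smul_eq_mul, stdGaussianPDFReal_mul_exp_mul_sq_norm]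
  exact (integrable_exp_neg_mul_sq_norm (sub_pos.2 ha)).const_mul _

lemma integral_exp_mul_sq_norm_stdGaussian {a : ℝ} (ha : a < 1 / 2) :
    ∫ x : E, Real.exp (a * ‖x‖ ^ 2) ∂stdGaussian E =
      (1 - 2 * a) ^ (-(Module.finrank ℝ E / 2 : ℝ)) := by
  have hb : 0 < 1 / 2 - a := sub_pos.2 ha
  have base_eq : 1 - 2 * a = 2 * Real.pi * (Real.pi / (1 / 2 - a))⁻¹ := by
    field_simp
  simp only [integral_stdGaussian, smul_eq_mul, stdGaussianPDFReal_mul_exp_mul_sq_norm]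
  rw [integral_const_mul, GaussianFourier.integral_rexp_neg_mul_sq_norm hb, base_eq,
    Real.mul_rpow Real.two_pi_pos.le (by positivity), Real.inv_rpow (by positivity),
    Real.rpow_neg (by positivity : 0 ≤ Real.pi / (1 / 2 - a)), inv_inv]

lemma integrable_exp_mul_norm_stdGaussian (l : ℝ) :
    Integrable (fun x : E => Real.exp (l * ‖x‖)) (stdGaussian E) := by
  have ha : (1 / 4 : ℝ) < 1 / 2 := by norm_num
  refine ((integrable_exp_mul_sq_norm_stdGaussian E ha).const_mul
    (Real.exp (l ^ 2 / (4 * (1 / 4))))).mono' (by fun_prop) (ae_of_all _ fun x => ?_)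
  rw [Real.norm_of_nonneg (Real.exp_pos _).le, ← Real.exp_add]
  exact Real.exp_le_exp.2 (mul_le_sq_div_add_mul_sq (by norm_num) l ‖x‖)

lemma integral_exp_mul_norm_stdGaussian_le_rpow {a l : ℝ} (ha₀ : 0 < a) (ha : a < 1 / 2) :
    ∫ x : E, Real.exp (l * ‖x‖) ∂stdGaussian E ≤
      Real.exp (l ^ 2 / (4 * a)) * (1 - 2 * a) ^ (-(Module.finrank ℝ E / 2 : ℝ)) := by
  rw [← integral_exp_mul_sq_norm_stdGaussian E ha, ← integral_const_mul]
  refine integral_mono (integrable_exp_mul_norm_stdGaussian E l)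
    ((integrable_exp_mul_sq_norm_stdGaussian E ha).const_mul _) fun x => ?_
  rw [← Real.exp_add]
  exact Real.exp_le_exp.2 (mul_le_sq_div_add_mul_sq ha₀ l ‖x‖)

theorem integral_exp_mul_norm_stdGaussian_le {l : ℝ} (hl : 0 ≤ l) :
    ∫ x : E, Real.exp (l * ‖x‖) ∂stdGaussian E ≤
      Real.exp (l * √(Module.finrank ℝ E) + l ^ 2 / 2) := by
  rcases hl.eq_or_lt with rfl | hl
  · simp
  rcases subsingleton_or_nontrivial E with hE | hE
  · simp only [hE.eq_zero, norm_zero, mul_zero, Real.exp_zero, integral_const, probReal_univ,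
      one_smul]
    exact Real.one_le_exp (by positivity)
  set r := √(Module.finrank ℝ E : ℝ)
  have hr : 0 < r := Real.sqrt_pos.2 (Nat.cast_pos.2 Module.finrank_pos)
  have hrd : (Module.finrank ℝ E : ℝ) = r ^ 2 := (Real.sq_sqrt (Nat.cast_nonneg _)).symm
  -- With `1 - 2 * a = r / (r + l)` the two exponents below add up exactly to the claimed one.
  set a : ℝ := l / (2 * (r + l)) with ha
  have one_sub : 1 - 2 * a = r / (r + l) := by rw [ha]; field_simp; ring
  have ha_lt : a < 1 / 2 := by linarith [show 0 < r / (r + l) by positivity]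
  have rpow_le : (1 - 2 * a) ^ (-(Module.finrank ℝ E / 2 : ℝ)) ≤
      Real.exp (l / r * (r ^ 2 / 2)) := by
    rw [one_sub, hrd, Real.rpow_neg (by positivity), ← Real.inv_rpow (by positivity), inv_div,
      Real.exp_mul, add_div, div_self hr.ne', add_comm]
    exact Real.rpow_le_rpow (by positivity) (Real.add_one_le_exp _) (by positivity)
  calc ∫ x : E, Real.exp (l * ‖x‖) ∂stdGaussian E
      ≤ Real.exp (l ^ 2 / (4 * a)) * (1 - 2 * a) ^ (-(Module.finrank ℝ E / 2 : ℝ)) :=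
        integral_exp_mul_norm_stdGaussian_le_rpow E (by positivity) ha_lt
    _ ≤ Real.exp (l ^ 2 / (4 * a)) * Real.exp (l / r * (r ^ 2 / 2)) := by gcongr
    _ = Real.exp (l * r + l ^ 2 / 2) := by
        rw [← Real.exp_add, ha]
        congr 1
        field_simp
        ring

end NormMoments

/-! ### Functions of exponential growth -/

section ExpGrowth

variable {E F : Type*} [NormedAddCommGroup E] [NormedAddCommGroup F]

/-- `f` grows at most exponentially in the norm of its argument. This is the integrability class in
which Gaussian expectations may be differentiated freely. -/
def HasExpGrowth (f : E → F) : Prop :=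
  ∃ C c : ℝ, 0 ≤ C ∧ 0 ≤ c ∧ ∀ x, ‖f x‖ ≤ C * Real.exp (c * ‖x‖)

namespace HasExpGrowth

variable {f g : E → F}

lemma const (y : F) : HasExpGrowth fun _ : E => y :=
  ⟨‖y‖, 0, norm_nonneg y, le_rfl, by simp⟩

lemma add (hf : HasExpGrowth f) (hg : HasExpGrowth g) : HasExpGrowth fun x => f x + g x := by
  obtain ⟨C, c, hC, hc, hf⟩ := hf
  obtain ⟨D, d, hD, -, hg⟩ := hg
  refine ⟨C + D, max c d, by positivity, by positivity, fun x => ?_⟩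
  calc ‖f x + g x‖ ≤ C * Real.exp (c * ‖x‖) + D * Real.exp (d * ‖x‖) :=
        norm_add_le_of_le (hf x) (hg x)
    _ ≤ C * Real.exp (max c d * ‖x‖) + D * Real.exp (max c d * ‖x‖) := by
        gcongr
        exacts [le_max_left c d, le_max_right c d]
    _ = (C + D) * Real.exp (max c d * ‖x‖) := (add_mul _ _ _).symm

lemma sum {ι : Type*} {s : Finset ι} {f : ι → E → F} (hf : ∀ i ∈ s, HasExpGrowth (f i)) :
    HasExpGrowth fun x => ∑ i ∈ s, f i x := by
  classical
  induction s using Finset.induction_on with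
  | empty => simpa using const (0 : F)
  | insert i s hi ih =>
    simp only [Finset.sum_insert hi]
    exact (hf i (Finset.mem_insert_self i s)).add
      (ih fun j hj => hf j (Finset.mem_insert_of_mem hj))

lemma comp_continuousLinearMap [NormedSpace ℝ E] {G : Type*} [NormedAddCommGroup G]
    [NormedSpace ℝ G] (hf : HasExpGrowth f) (A : G →L[ℝ] E) : HasExpGrowth fun x => f (A x) := by
  obtain ⟨C, c, hC, hc, hf⟩ := hf
  refine ⟨C, c * ‖A‖, hC, by positivity, fun x => (hf (A x)).trans ?_⟩
  rw [mul_assoc]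
  gcongr
  exact A.le_opNorm x

variable [NormedSpace ℝ F]

lemma smul {u : E → ℝ} (hu : HasExpGrowth u) (hf : HasExpGrowth f) :
    HasExpGrowth fun x => u x • f x := by
  obtain ⟨C, c, hC, hc, hu⟩ := hu
  obtain ⟨D, d, hD, hd, hf⟩ := hf
  refine ⟨C * D, c + d, by positivity, by positivity, fun x => ?_⟩
  calc ‖u x • f x‖ ≤ (C * Real.exp (c * ‖x‖)) * (D * Real.exp (d * ‖x‖)) := by
        rw [norm_smul]
        gcongr
        exacts [hu x, hf x]
    _ = C * D * Real.exp ((c + d) * ‖x‖) := by rw [add_mul, Real.exp_add]; ring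

lemma mul {u v : E → ℝ} (hu : HasExpGrowth u) (hv : HasExpGrowth v) :
    HasExpGrowth fun x => u x * v x :=
  hu.smul hv

lemma of_continuousLinearMap [NormedSpace ℝ E] (A : E →L[ℝ] F) : HasExpGrowth A := by
  refine ⟨‖A‖, 1, norm_nonneg A, zero_le_one, fun x => (A.le_opNorm x).trans ?_⟩
  gcongr
  linarith [Real.add_one_le_exp (1 * ‖x‖)]

end HasExpGrowth

lemma HasExpGrowth.integrable_stdGaussian {E : Type*} [NormedAddCommGroup E]
    [InnerProductSpace ℝ E] [FiniteDimensional ℝ E] [MeasurableSpace E] [BorelSpace E]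
    {f : E → ℝ} (hf : HasExpGrowth f) (hfc : Continuous f) : Integrable f (stdGaussian E) := by
  obtain ⟨C, c, -, -, hf⟩ := hf
  exact ((integrable_exp_mul_norm_stdGaussian E c).const_mul C).mono'
    hfc.aestronglyMeasurable (ae_of_all _ hf)

end ExpGrowth

/-! ### Gaussian comparison -/

section Comparison

/-- The linear map `x ↦ (⟪a k, x⟫)ₖ`. Under the standard Gaussian measure it is a centred Gaussian
vector whose covariance matrix is the Gram matrix of `a`. -/
noncomputable def innerCoords {E ι : Type*} [NormedAddCommGroup E] [InnerProductSpace ℝ E]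
    (a : ι → E) : E →L[ℝ] ι → ℝ :=
  ContinuousLinearMap.pi fun k => innerSL ℝ (a k)

@[simp]
lemma innerCoords_apply {E ι : Type*} [NormedAddCommGroup E] [InnerProductSpace ℝ E]
    (a : ι → E) (x : E) (k : ι) : innerCoords a x k = inner ℝ (a k) x :=
  rfl

variable {E : Type*} [NormedAddCommGroup E] [InnerProductSpace ℝ E] [FiniteDimensional ℝ E]
  [MeasurableSpace E] [BorelSpace E]

section Path

variable {V : Type*} [NormedAddCommGroup V] [NormedSpace ℝ V]

theorem hasDerivAt_integral_comp_stdGaussian {F : V → ℝ} {F' : V → V →L[ℝ] ℝ}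
    {A A' : ℝ → E →L[ℝ] V} {R : ℝ} (hF : ∀ z, HasFDerivAt F (F' z) z)
    (hFg : HasExpGrowth F) (hF'c : Continuous F') (hF'g : HasExpGrowth F')
    (hA : ∀ θ, HasDerivAt A (A' θ) θ) (hAR : ∀ θ, ‖A θ‖ ≤ R) (hA'R : ∀ θ, ‖A' θ‖ ≤ R) (θ : ℝ) :
    HasDerivAt (fun θ => ∫ x, F (A θ x) ∂stdGaussian E)
      (∫ x, F' (A θ x) (A' θ x) ∂stdGaussian E) θ := by
  have hFc : Continuous F := continuous_iff_continuousAt.2 fun z => (hF z).continuousAt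
  have hR : 0 ≤ R := (norm_nonneg _).trans (hAR 0)
  have norm_le : ∀ θ x, ‖A θ x‖ ≤ R * ‖x‖ := fun θ x => (A θ).le_of_opNorm_le (hAR θ) x
  have norm_le' : ∀ θ x, ‖A' θ x‖ ≤ R * ‖x‖ := fun θ x => (A' θ).le_of_opNorm_le (hA'R θ) x
  obtain ⟨C, c, hC, hc, hF'le⟩ := hF'g
  have bound : ∀ θ x,
      ‖F' (A θ x) (A' θ x)‖ ≤ C * R * Real.exp ((c * R + 1) * ‖x‖) := fun θ x =>
    calc ‖F' (A θ x) (A' θ x)‖ ≤ ‖F' (A θ x)‖ * ‖A' θ x‖ := (F' _).le_opNorm _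
      _ ≤ (C * Real.exp (c * (R * ‖x‖))) * (R * Real.exp ‖x‖) := by
        gcongr
        · exact (hF'le _).trans (by gcongr; exact norm_le θ x)
        · refine (norm_le' θ x).trans ?_
          gcongr
          linarith [Real.add_one_le_exp ‖x‖]
      _ = C * R * Real.exp ((c * R + 1) * ‖x‖) := by
        rw [add_mul, Real.exp_add, one_mul, mul_assoc c]; ring
  refine (hasDerivAt_integral_of_dominated_loc_of_deriv_le (F := fun θ x => F (A θ x))
    (F' := fun θ x => F' (A θ x) (A' θ x)) Filter.univ_mem
    (Filter.Eventually.of_forall fun θ => (hFc.comp (A θ).continuous).aestronglyMeasurable)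
    ((hFg.comp_continuousLinearMap (A θ)).integrable_stdGaussian (hFc.comp (A θ).continuous))
    ?_ (ae_of_all _ fun x θ _ => bound θ x)
    ((integrable_exp_mul_norm_stdGaussian E _).const_mul _) (ae_of_all _ fun x θ _ => ?_)).2
  · exact ((hF'c.comp (A θ).continuous).clm_apply (A' θ).continuous).aestronglyMeasurable
  · simpa [Function.comp_def] using
      (hF _).comp_hasDerivAt θ ((hA θ).clm_apply (hasDerivAt_const θ x))

end Path

variable {ι : Type*} [Fintype ι]

theorem integral_inner_mul_comp_innerCoords (a : ι → E) (b : E) {g : (ι → ℝ) → ℝ}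
    {h : ι → (ι → ℝ) → ℝ}
    (hg : ∀ z, HasFDerivAt g (∑ j, h j z • ContinuousLinearMap.proj (R := ℝ) j) z)
    (hgg : HasExpGrowth g) (hhc : ∀ j, Continuous (h j)) (hhg : ∀ j, HasExpGrowth (h j)) :
    ∫ x, inner ℝ b x * g (innerCoords a x) ∂stdGaussian E =
      ∑ j, inner ℝ (a j) b * ∫ x, h j (innerCoords a x) ∂stdGaussian E := by
  have hgc : Continuous fun x => g (innerCoords a x) :=
    (continuous_iff_continuousAt.2 fun z => (hg z).continuousAt).comp (innerCoords a).continuous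
  have hhi : ∀ j, Integrable (fun x => inner ℝ (a j) b * h j (innerCoords a x)) (stdGaussian E) :=
    fun j => (((hhg j).comp_continuousLinearMap _).integrable_stdGaussian
      ((hhc j).comp (innerCoords a).continuous)).const_mul _
  have hderiv : ∀ x, HasFDerivAt (fun x => g (innerCoords a x))
      ((∑ j, h j (innerCoords a x) • ContinuousLinearMap.proj (R := ℝ) j).comp
        (innerCoords a)) x := fun x => (hg _).comp x (innerCoords a).hasFDerivAt
  have deriv_apply : ∀ x, ((∑ j, h j (innerCoords a x) • ContinuousLinearMap.proj (R := ℝ) j).comp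
      (innerCoords a)) b = ∑ j, inner ℝ (a j) b * h j (innerCoords a x) := fun x => by
    simp [mul_comm]
  have hgg' := hgg.comp_continuousLinearMap (innerCoords a)
  rw [integral_inner_mul_stdGaussian hderiv b (hgg'.integrable_stdGaussian hgc)
    (by simpa only [deriv_apply] using integrable_finsetSum _ fun j _ => hhi j)
    (((HasExpGrowth.of_continuousLinearMap (innerSL ℝ b)).mul hgg').integrable_stdGaussian
      ((innerSL ℝ b).continuous.mul hgc))]
  simp_rw [deriv_apply]
  rw [integral_finsetSum _ fun j _ => hhi j]
  simp_rw [integral_const_mul]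

/-- `F` is twice continuously differentiable with partial derivatives `G k` and second partial
derivatives `H k j`, all of exponential growth. Regularity assumption of Gaussian interpolation. -/
structure HasExpGrowthHessian (F : (ι → ℝ) → ℝ) (G : ι → (ι → ℝ) → ℝ)
    (H : ι → ι → (ι → ℝ) → ℝ) : Prop where
  hasFDerivAt : ∀ z, HasFDerivAt F (∑ k, G k z • ContinuousLinearMap.proj (R := ℝ) k) z
  hasFDerivAt_grad : ∀ k z,
    HasFDerivAt (G k) (∑ j, H k j z • ContinuousLinearMap.proj (R := ℝ) j) z
  continuous_hess : ∀ k j, Continuous (H k j)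
  growth : HasExpGrowth F
  growth_grad : ∀ k, HasExpGrowth (G k)
  growth_hess : ∀ k j, HasExpGrowth (H k j)

namespace HasExpGrowthHessian

variable {F : (ι → ℝ) → ℝ} {G : ι → (ι → ℝ) → ℝ} {H : ι → ι → (ι → ℝ) → ℝ}

lemma continuous (hF : HasExpGrowthHessian F G H) : Continuous F :=
  continuous_iff_continuousAt.2 fun z => (hF.hasFDerivAt z).continuousAt

lemma continuous_grad (hF : HasExpGrowthHessian F G H) (k : ι) : Continuous (G k) :=
  continuous_iff_continuousAt.2 fun z => (hF.hasFDerivAt_grad k z).continuousAt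

lemma hasDerivAt_integral_rotation (hF : HasExpGrowthHessian F G H) (p q : ι → E) (θ : ℝ) :
    HasDerivAt
      (fun θ => ∫ x, F (innerCoords (fun k => Real.cos θ • p k + Real.sin θ • q k) x)
        ∂stdGaussian E)
      (∑ k, ∑ j, inner ℝ (Real.cos θ • p j + Real.sin θ • q j)
          (-Real.sin θ • p k + Real.cos θ • q k) *
        ∫ x, H k j (innerCoords (fun k => Real.cos θ • p k + Real.sin θ • q k) x)
          ∂stdGaussian E) θ := by
  have coords_eq : ∀ c s : ℝ, innerCoords (fun k => c • p k + s • q k) =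
      c • innerCoords p + s • innerCoords q := fun c s => by
    ext x k
    simp [inner_add_left, real_inner_smul_left]
  have norm_le : ∀ c s : ℝ, |c| ≤ 1 → |s| ≤ 1 →
      ‖innerCoords (fun k => c • p k + s • q k)‖ ≤ ‖innerCoords p‖ + ‖innerCoords q‖ := by
    intro c s hc hs
    rw [coords_eq]
    refine norm_add_le_of_le ?_ ?_ <;> rw [norm_smul]
    exacts [mul_le_of_le_one_left (norm_nonneg _) hc, mul_le_of_le_one_left (norm_nonneg _) hs]
  have key := hasDerivAt_integral_comp_stdGaussian (E := E)
    (A := fun θ => innerCoords fun k => Real.cos θ • p k + Real.sin θ • q k)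
    (A' := fun θ => innerCoords fun k => -Real.sin θ • p k + Real.cos θ • q k)
    (R := ‖innerCoords p‖ + ‖innerCoords q‖) hF.hasFDerivAt hF.growth
    (by have := hF.continuous_grad; fun_prop)
    (.sum fun k _ => (hF.growth_grad k).smul (.const _))
    (fun θ => by
      simp only [coords_eq]
      exact ((Real.hasDerivAt_cos θ).smul_const (innerCoords p)).add
        ((Real.hasDerivAt_sin θ).smul_const (innerCoords q)))
    (fun θ => norm_le _ _ (Real.abs_cos_le_one θ) (Real.abs_sin_le_one θ))
    (fun θ => norm_le _ _ (by rw [abs_neg]; exact Real.abs_sin_le_one θ)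
      (Real.abs_cos_le_one θ)) θ
  refine key.congr_deriv ?_
  set a : ι → E := fun k => Real.cos θ • p k + Real.sin θ • q k
  set b : ι → E := fun k => -Real.sin θ • p k + Real.cos θ • q k
  calc ∫ x, (∑ k, G k (innerCoords a x) • ContinuousLinearMap.proj (R := ℝ) k)
        (innerCoords b x) ∂stdGaussian E
      = ∫ x, ∑ k, inner ℝ (b k) x * G k (innerCoords a x) ∂stdGaussian E := by
        simp [mul_comm]
    _ = ∑ k, ∫ x, inner ℝ (b k) x * G k (innerCoords a x) ∂stdGaussian E := by
        refine integral_finsetSum _ fun k _ => ?_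
        exact ((HasExpGrowth.of_continuousLinearMap (innerSL ℝ (b k))).mul
          ((hF.growth_grad k).comp_continuousLinearMap _)).integrable_stdGaussian
          ((innerSL ℝ (b k)).continuous.mul
            ((hF.continuous_grad k).comp (innerCoords a).continuous))
    _ = _ := Finset.sum_congr rfl fun k _ => integral_inner_mul_comp_innerCoords a (b k)
        (hF.hasFDerivAt_grad k) (hF.growth_grad k) (hF.continuous_hess k) (hF.growth_hess k)

theorem integral_innerCoords_le_of_orthogonal (hF : HasExpGrowthHessian F G H)
    (hH : ∀ k j, j ≠ k → ∀ z, H k j z ≤ 0) {p q : ι → E}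
    (hpq : ∀ j k, inner ℝ (p j) (q k) = 0) (hnorm : ∀ k, ‖p k‖ = ‖q k‖)
    (hinner : ∀ j k, inner ℝ (q j) (q k) ≤ inner ℝ (p j) (p k)) :
    ∫ x, F (innerCoords p x) ∂stdGaussian E ≤ ∫ x, F (innerCoords q x) ∂stdGaussian E := by
  have hqp : ∀ j k, inner ℝ (q j) (p k) = 0 := fun j k => by rw [real_inner_comm, hpq]
  have inner_deriv : ∀ θ j k, inner ℝ (Real.cos θ • p j + Real.sin θ • q j)
      (-Real.sin θ • p k + Real.cos θ • q k) =
      Real.sin θ * Real.cos θ * (inner ℝ (q j) (q k) - inner ℝ (p j) (p k)) := fun θ j k => by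
    simp only [inner_add_left, inner_add_right, real_inner_smul_left, real_inner_smul_right,
      hpq, hqp]
    ring
  have hderiv := hF.hasDerivAt_integral_rotation p q
  have mono := monotoneOn_of_deriv_nonneg (convex_Icc 0 (Real.pi / 2))
    (fun θ _ => (hderiv θ).continuousAt.continuousWithinAt)
    (fun θ _ => (hderiv θ).differentiableAt.differentiableWithinAt) fun θ hθ => by
      rw [interior_Icc] at hθ
      have hsin : 0 ≤ Real.sin θ :=
        Real.sin_nonneg_of_nonneg_of_le_pi hθ.1.le (by linarith [hθ.2, Real.pi_pos])
      have hcos : 0 ≤ Real.cos θ :=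
        Real.cos_nonneg_of_neg_pi_div_two_le_of_le (by linarith [hθ.1, Real.pi_pos]) hθ.2.le
      rw [(hderiv θ).deriv]
      refine Finset.sum_nonneg fun k _ => Finset.sum_nonneg fun j _ => ?_
      rw [inner_deriv]
      rcases eq_or_ne j k with rfl | hjk
      · simp [hnorm]
      · exact mul_nonneg_of_nonpos_of_nonpos
          (mul_nonpos_of_nonneg_of_nonpos (mul_nonneg hsin hcos) (sub_nonpos.2 (hinner j k)))
          (integral_nonpos fun x => hH k j hjk _)
  have hpi : 0 ≤ Real.pi / 2 := by positivity
  simpa using mono (Set.left_mem_Icc.2 hpi) (Set.right_mem_Icc.2 hpi) hpi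

end HasExpGrowthHessian

end Comparison

section Product

variable {X : Type*} [NormedAddCommGroup X] [InnerProductSpace ℝ X] [FiniteDimensional ℝ X]
  [MeasurableSpace X] [BorelSpace X]
  {Y : Type*} [NormedAddCommGroup Y] [InnerProductSpace ℝ Y] [FiniteDimensional ℝ Y]
  [MeasurableSpace Y] [BorelSpace Y]

lemma stdGaussian_withLp_prod :
    stdGaussian (WithLp 2 (X × Y)) =
      ((stdGaussian X).prod (stdGaussian Y)).map (WithLp.toLp 2) := by
  have : IsProbabilityMeasure (((stdGaussian X).prod (stdGaussian Y)).map (WithLp.toLp 2)) :=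
    Measure.isProbabilityMeasure_map (by fun_prop)
  refine Measure.ext_of_charFun (funext fun t => ?_)
  rw [charFun_prod, charFun_stdGaussian, charFun_stdGaussian, charFun_stdGaussian,
    ← Complex.exp_add, ← Complex.ofReal_pow, WithLp.prod_norm_sq_eq_of_L2]
  congr 1
  push_cast
  simp only [WithLp.fst, WithLp.snd]
  ring

lemma integral_mul_stdGaussian_prod (f : X → ℝ) (g : Y → ℝ) :
    ∫ x : WithLp 2 (X × Y), f x.fst * g x.snd ∂stdGaussian (WithLp 2 (X × Y)) =
      (∫ x, f x ∂stdGaussian X) * ∫ y, g y ∂stdGaussian Y := by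
  rw [stdGaussian_withLp_prod, ← MeasurableEquiv.coe_toLp, integral_map_equiv]
  exact integral_prod_mul f g

lemma integral_fst_stdGaussian_prod (f : X → ℝ) :
    ∫ x : WithLp 2 (X × Y), f x.fst ∂stdGaussian (WithLp 2 (X × Y)) = ∫ x, f x ∂stdGaussian X := by
  simpa using integral_mul_stdGaussian_prod (Y := Y) f fun _ => 1

lemma integral_snd_stdGaussian_prod (g : Y → ℝ) :
    ∫ x : WithLp 2 (X × Y), g x.snd ∂stdGaussian (WithLp 2 (X × Y)) = ∫ y, g y ∂stdGaussian Y := by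
  simpa using integral_mul_stdGaussian_prod (X := X) (fun _ => 1) g

variable {ι : Type*} [Fintype ι] {F : (ι → ℝ) → ℝ} {G : ι → (ι → ℝ) → ℝ}
  {H : ι → ι → (ι → ℝ) → ℝ}

theorem HasExpGrowthHessian.integral_innerCoords_le (hF : HasExpGrowthHessian F G H)
    (hH : ∀ k j, j ≠ k → ∀ z, H k j z ≤ 0) {p : ι → X} {q : ι → Y} (hnorm : ∀ k, ‖p k‖ = ‖q k‖)
    (hinner : ∀ j k, inner ℝ (q j) (q k) ≤ inner ℝ (p j) (p k)) :
    ∫ x, F (innerCoords p x) ∂stdGaussian X ≤ ∫ y, F (innerCoords q y) ∂stdGaussian Y := by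
  let p' : ι → WithLp 2 (X × Y) := fun k => WithLp.toLp 2 (p k, 0)
  let q' : ι → WithLp 2 (X × Y) := fun k => WithLp.toLp 2 (0, q k)
  have coords_p : ∀ w, innerCoords p' w = innerCoords p w.fst := fun w => by
    ext k; simp [p', WithLp.prod_inner_apply]
  have coords_q : ∀ w, innerCoords q' w = innerCoords q w.snd := fun w => by
    ext k; simp [q', WithLp.prod_inner_apply]
  have orthogonal_le := hF.integral_innerCoords_le_of_orthogonal hH (p := p') (q := q')
    (by simp [p', q', WithLp.prod_inner_apply]) (by simp [p', q', hnorm])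
    (by simpa [p', q', WithLp.prod_inner_apply] using hinner)
  simpa only [coords_p, coords_q, integral_fst_stdGaussian_prod (fun x => F (innerCoords p x)),
    integral_snd_stdGaussian_prod (fun y => F (innerCoords q y))] using orthogonal_le

end Product

/-! ### Slepian's inequality -/

section Slepian

variable {X : Type*} [NormedAddCommGroup X] [InnerProductSpace ℝ X] [FiniteDimensional ℝ X]
  [MeasurableSpace X] [BorelSpace X]
  {Y : Type*} [NormedAddCommGroup Y] [InnerProductSpace ℝ Y] [FiniteDimensional ℝ Y]
  [MeasurableSpace Y] [BorelSpace Y]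

section ExpSum

lemma hasFDerivAt_exp_mul_apply {ι : Type*} [Finite ι] (β : ℝ) (k : ι) (z : ι → ℝ) :
    HasFDerivAt (fun z : ι → ℝ => Real.exp (β * z k))
      ((β * Real.exp (β * z k)) • ContinuousLinearMap.proj (R := ℝ) k) z := by
  have := Fintype.ofFinite ι
  refine (((ContinuousLinearMap.proj (R := ℝ) k).hasFDerivAt (x := z)).const_mul β).exp.congr_fderiv
    ?_
  simp [smul_smul, mul_comm]

variable {ι : Type*} [Fintype ι]

/-- The sum `∑ exp (β zₖ)`, whose power `1 / β` is a smooth approximation of `exp (max zₖ)` for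
large `β`. -/
noncomputable def expSum (β : ℝ) (z : ι → ℝ) : ℝ :=
  ∑ k, Real.exp (β * z k)

section Derivatives

lemma continuous_expSum (β : ℝ) : Continuous (expSum β : (ι → ℝ) → ℝ) := by
  unfold expSum; fun_prop

lemma hasExpGrowth_exp_mul_apply (β : ℝ) (k : ι) :
    HasExpGrowth fun z : ι → ℝ => Real.exp (β * z k) := by
  refine ⟨1, |β|, zero_le_one, abs_nonneg β, fun z => ?_⟩
  rw [one_mul, Real.norm_of_nonneg (Real.exp_pos _).le]
  refine Real.exp_le_exp.2 ?_
  calc β * z k ≤ |β| * |z k| := (le_abs_self _).trans_eq (abs_mul _ _)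
    _ ≤ |β| * ‖z‖ := by gcongr; exact norm_le_pi_norm z k

variable [Nonempty ι]

lemma expSum_pos (β : ℝ) (z : ι → ℝ) : 0 < expSum β z :=
  Finset.sum_pos (fun _ _ => Real.exp_pos _) Finset.univ_nonempty

lemma continuous_expSum_rpow (β s : ℝ) : Continuous fun z : ι → ℝ => expSum β z ^ s :=
  (continuous_expSum β).rpow_const fun z => .inl (expSum_pos β z).ne'

lemma hasFDerivAt_expSum_rpow (β s : ℝ) (z : ι → ℝ) :
    HasFDerivAt (fun z : ι → ℝ => expSum β z ^ s)
      (∑ j, (s * β * (Real.exp (β * z j) * expSum β z ^ (s - 1))) •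
        ContinuousLinearMap.proj (R := ℝ) (φ := fun _ : ι => ℝ) j) z := by
  have hsum : HasFDerivAt (expSum β) (∑ j, (β * Real.exp (β * z j)) •
      ContinuousLinearMap.proj (R := ℝ) (φ := fun _ : ι => ℝ) j) z :=
    HasFDerivAt.fun_sum fun j _ => hasFDerivAt_exp_mul_apply β j z
  refine (hsum.rpow_const (.inl (expSum_pos β z).ne')).congr_fderiv ?_
  rw [Finset.smul_sum]
  refine Finset.sum_congr rfl fun j _ => ?_
  rw [smul_smul]
  ring_nf

lemma abs_log_expSum_le (β : ℝ) (z : ι → ℝ) :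
    |Real.log (expSum β z)| ≤ Real.log (Fintype.card ι) + |β| * ‖z‖ := by
  have abs_mul_apply_le : ∀ k, |β * z k| ≤ |β| * ‖z‖ := fun k => by
    rw [abs_mul]; gcongr; exact norm_le_pi_norm z k
  have hcard : (1 : ℝ) ≤ Fintype.card ι := by exact_mod_cast Fintype.card_pos
  have upper : expSum β z ≤ Fintype.card ι * Real.exp (|β| * ‖z‖) := by
    refine (Finset.sum_le_card_nsmul _ _ (Real.exp (|β| * ‖z‖)) fun k _ => ?_).trans_eq (by simp)
    exact Real.exp_le_exp.2 (le_of_abs_le (abs_mul_apply_le k))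
  have lower : Real.exp (-(|β| * ‖z‖)) ≤ expSum β z := by
    obtain ⟨k⟩ := ‹Nonempty ι›
    exact (Real.exp_le_exp.2 (neg_le_of_abs_le (abs_mul_apply_le k))).trans
      (Finset.single_le_sum (f := fun k => Real.exp (β * z k)) (fun _ _ => (Real.exp_pos _).le)
        (Finset.mem_univ k))
  have log_upper := Real.log_le_log (expSum_pos β z) upper
  have log_lower := Real.log_le_log (Real.exp_pos _) lower
  rw [Real.log_mul (by positivity) (Real.exp_pos _).ne', Real.log_exp] at log_upper
  rw [Real.log_exp] at log_lower
  exact abs_le.2 ⟨by linarith [Real.log_nonneg hcard], log_upper⟩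

lemma hasExpGrowth_expSum_rpow (β s : ℝ) : HasExpGrowth fun z : ι → ℝ => expSum β z ^ s := by
  refine ⟨Real.exp (|s| * Real.log (Fintype.card ι)), |s| * |β|, by positivity, by positivity,
    fun z => ?_⟩
  rw [Real.norm_of_nonneg (Real.rpow_nonneg (expSum_pos β z).le _),
    Real.rpow_def_of_pos (expSum_pos β z), ← Real.exp_add]
  refine Real.exp_le_exp.2 ?_
  calc Real.log (expSum β z) * s ≤ |Real.log (expSum β z)| * |s| :=
        (le_abs_self _).trans_eq (abs_mul _ _)
    _ ≤ (Real.log (Fintype.card ι) + |β| * ‖z‖) * |s| := by gcongr; exact abs_log_expSum_le β z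
    _ = |s| * Real.log (Fintype.card ι) + |s| * |β| * ‖z‖ := by ring

lemma continuous_exp_mul_apply_mul_expSum_rpow (β s : ℝ) (k : ι) :
    Continuous fun z : ι → ℝ => Real.exp (β * z k) * expSum β z ^ s :=
  (by fun_prop : Continuous fun z : ι → ℝ => Real.exp (β * z k)).mul (continuous_expSum_rpow β s)

lemma hasExpGrowth_exp_mul_apply_mul_expSum_rpow (β s : ℝ) (k : ι) :
    HasExpGrowth fun z : ι → ℝ => Real.exp (β * z k) * expSum β z ^ s :=
  (hasExpGrowth_exp_mul_apply β k).mul (hasExpGrowth_expSum_rpow β s)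

variable [DecidableEq ι]

/-- The partial derivative in the direction `j` of `exp (β zₖ) (∑ exp (β zᵢ)) ^ s`. -/
noncomputable def expMulExpSumRpowDeriv (β s : ℝ) (k j : ι) (z : ι → ℝ) : ℝ :=
  β * ((if j = k then Real.exp (β * z k) * expSum β z ^ s else 0) +
    s * (Real.exp (β * z k) * (Real.exp (β * z j) * expSum β z ^ (s - 1))))

lemma hasFDerivAt_exp_mul_apply_mul_expSum_rpow (β s : ℝ) (k : ι) (z : ι → ℝ) :
    HasFDerivAt (fun z : ι → ℝ => Real.exp (β * z k) * expSum β z ^ s)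
      (∑ j, expMulExpSumRpowDeriv β s k j z •
        ContinuousLinearMap.proj (R := ℝ) (φ := fun _ : ι => ℝ) j) z := by
  refine ((hasFDerivAt_exp_mul_apply β k z).mul (hasFDerivAt_expSum_rpow β s z)).congr_fderiv ?_
  ext v
  simp only [expMulExpSumRpowDeriv, mul_add, mul_ite, mul_zero, add_smul, ite_smul, zero_smul,
    Finset.sum_add_distrib, Finset.sum_ite_eq', Finset.mem_univ, if_true, add_apply, smul_apply,
    sum_apply, ContinuousLinearMap.proj_apply, smul_eq_mul, Finset.mul_sum]
  rw [add_comm]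
  congr 1
  · ring
  · exact Finset.sum_congr rfl fun j _ => by ring

lemma continuous_expMulExpSumRpowDeriv (β s : ℝ) (k j : ι) :
    Continuous (expMulExpSumRpowDeriv β s k j) := by
  have hcont := continuous_exp_mul_apply_mul_expSum_rpow (ι := ι) β
  unfold expMulExpSumRpowDeriv
  split_ifs <;> have := hcont s k <;> have := hcont (s - 1) j <;> fun_prop

lemma hasExpGrowth_expMulExpSumRpowDeriv (β s : ℝ) (k j : ι) :
    HasExpGrowth (expMulExpSumRpowDeriv β s k j) := by
  have hgrowth := hasExpGrowth_exp_mul_apply_mul_expSum_rpow (ι := ι) β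
  refine (HasExpGrowth.const β).mul (.add ?_ ((HasExpGrowth.const s).mul
    ((hasExpGrowth_exp_mul_apply β k).mul (hgrowth (s - 1) j))))
  split_ifs
  exacts [hgrowth s k, .const 0]

lemma hasExpGrowthHessian_expSum_rpow (β r : ℝ) :
    HasExpGrowthHessian (fun z : ι → ℝ => expSum β z ^ r)
      (fun k z => r * β * (Real.exp (β * z k) * expSum β z ^ (r - 1)))
      (fun k j z => r * β * expMulExpSumRpowDeriv β (r - 1) k j z) where
  hasFDerivAt := hasFDerivAt_expSum_rpow β r
  hasFDerivAt_grad k z := by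
    refine ((hasFDerivAt_exp_mul_apply_mul_expSum_rpow β (r - 1) k z).const_mul
      (r * β)).congr_fderiv ?_
    simp only [Finset.smul_sum, smul_smul]
  continuous_hess k j := (continuous_expMulExpSumRpowDeriv β (r - 1) k j).const_mul _
  growth := hasExpGrowth_expSum_rpow β r
  growth_grad k := (HasExpGrowth.const _).mul
    (hasExpGrowth_exp_mul_apply_mul_expSum_rpow β (r - 1) k)
  growth_hess k j := (HasExpGrowth.const _).mul (hasExpGrowth_expMulExpSumRpowDeriv β (r - 1) k j)

end Derivatives

variable [Nonempty ι]

lemma exp_mul_ciSup_le_expSum_rpow {β r : ℝ} (hr : 0 ≤ r) (z : ι → ℝ) :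
    Real.exp (β * r * ⨆ k, z k) ≤ expSum β z ^ r := by
  obtain ⟨k, hk⟩ := exists_eq_ciSup_of_finite (f := z)
  rw [← hk, mul_right_comm, Real.exp_mul]
  exact Real.rpow_le_rpow (Real.exp_pos _).le (Finset.single_le_sum
    (f := fun k => Real.exp (β * z k)) (fun _ _ => (Real.exp_pos _).le) (Finset.mem_univ k)) hr

lemma expSum_rpow_le_card_rpow_mul_exp {β r : ℝ} (hβ : 0 ≤ β) (hr : 0 ≤ r) (z : ι → ℝ) :
    expSum β z ^ r ≤ (Fintype.card ι : ℝ) ^ r * Real.exp (β * r * ⨆ k, z k) := by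
  have expSum_le : expSum β z ≤ Fintype.card ι * Real.exp (β * ⨆ k, z k) := by
    refine (Finset.sum_le_card_nsmul _ _ (Real.exp (β * ⨆ k, z k)) fun k _ => ?_).trans_eq
      (by simp)
    gcongr
    exact le_ciSup (Finite.bddAbove_range z) k
  calc expSum β z ^ r ≤ (Fintype.card ι * Real.exp (β * ⨆ k, z k)) ^ r :=
        Real.rpow_le_rpow (expSum_pos β z).le expSum_le hr
    _ = _ := by
      rw [Real.mul_rpow (Nat.cast_nonneg _) (Real.exp_pos _).le, ← Real.exp_mul, mul_right_comm]

lemma integrable_expSum_rpow_innerCoords (β r : ℝ) (p : ι → X) :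
    Integrable (fun x => expSum β (innerCoords p x) ^ r) (stdGaussian X) :=
  ((hasExpGrowth_expSum_rpow β r).comp_continuousLinearMap _).integrable_stdGaussian
    ((continuous_expSum_rpow β r).comp (innerCoords p).continuous)

lemma integral_expSum_rpow_innerCoords_le {β r : ℝ} (hr0 : 0 ≤ r) (hr1 : r ≤ 1) {p : ι → X}
    {q : ι → Y} (hnorm : ∀ k, ‖p k‖ = ‖q k‖)
    (hinner : ∀ j k, inner ℝ (q j) (q k) ≤ inner ℝ (p j) (p k)) :
    ∫ x, expSum β (innerCoords p x) ^ r ∂stdGaussian X ≤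
      ∫ y, expSum β (innerCoords q y) ^ r ∂stdGaussian Y := by
  classical
  refine (hasExpGrowthHessian_expSum_rpow β r).integral_innerCoords_le
    (fun k j hjk z => ?_) hnorm hinner
  have exp_mul_nonneg :
      0 ≤ Real.exp (β * z k) * (Real.exp (β * z j) * expSum β z ^ (r - 1 - 1)) := by
    have := expSum_pos β z
    positivity
  calc r * β * expMulExpSumRpowDeriv β (r - 1) k j z
      = r * β ^ 2 * (r - 1) *
          (Real.exp (β * z k) * (Real.exp (β * z j) * expSum β z ^ (r - 1 - 1))) := by
        rw [expMulExpSumRpowDeriv, if_neg hjk]; ring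
    _ ≤ 0 := mul_nonpos_of_nonpos_of_nonneg
        (mul_nonpos_of_nonneg_of_nonpos (by positivity) (by linarith)) exp_mul_nonneg

end ExpSum

variable {ι : Type*} [Finite ι] [Nonempty ι]

lemma integrable_exp_mul_ciSup_inner (l : ℝ) (p : ι → X) :
    Integrable (fun x => Real.exp (l * ⨆ k, inner ℝ (p k) x)) (stdGaussian X) := by
  have := Fintype.ofFinite ι
  refine (integrable_expSum_rpow_innerCoords l 1 p).mono' ?_ (ae_of_all _ fun x => ?_)
  · have : Measurable fun x => ⨆ k, inner ℝ (p k) x := .iSup fun k => by fun_prop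
    exact (this.const_mul l).exp.aestronglyMeasurable
  · simpa [abs_of_pos (Real.exp_pos _)] using
      exp_mul_ciSup_le_expSum_rpow (β := l) zero_le_one (innerCoords p x)

theorem mgf_ciSup_inner_stdGaussian_le {p : ι → X} {q : ι → Y} (hnorm : ∀ k, ‖p k‖ = ‖q k‖)
    (hinner : ∀ j k, inner ℝ (q j) (q k) ≤ inner ℝ (p j) (p k)) {l : ℝ} (hl : 0 ≤ l) :
    mgf (fun x => ⨆ k, inner ℝ (p k) x) (stdGaussian X) l ≤
      mgf (fun y => ⨆ k, inner ℝ (q k) y) (stdGaussian Y) l := by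
  have := Fintype.ofFinite ι
  have le_card_rpow_mul : ∀ r ∈ Set.Ioc (0 : ℝ) 1,
      mgf (fun x => ⨆ k, inner ℝ (p k) x) (stdGaussian X) l ≤
        (Fintype.card ι : ℝ) ^ r * mgf (fun y => ⨆ k, inner ℝ (q k) y) (stdGaussian Y) l := by
    rintro r ⟨hr0, hr1⟩
    have hβr : l / r * r = l := div_mul_cancel₀ l hr0.ne'
    calc mgf (fun x => ⨆ k, inner ℝ (p k) x) (stdGaussian X) l
        ≤ ∫ x, expSum (l / r) (innerCoords p x) ^ r ∂stdGaussian X :=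
          integral_mono (integrable_exp_mul_ciSup_inner l p)
            (integrable_expSum_rpow_innerCoords _ _ p) fun x => by
              simpa [hβr] using
                exp_mul_ciSup_le_expSum_rpow (β := l / r) hr0.le (innerCoords p x)
      _ ≤ ∫ y, expSum (l / r) (innerCoords q y) ^ r ∂stdGaussian Y :=
          integral_expSum_rpow_innerCoords_le hr0.le hr1 hnorm hinner
      _ ≤ ∫ y, (Fintype.card ι : ℝ) ^ r * Real.exp (l * ⨆ k, inner ℝ (q k) y) ∂stdGaussian Y :=
          integral_mono (integrable_expSum_rpow_innerCoords _ _ q)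
            ((integrable_exp_mul_ciSup_inner l q).const_mul _) fun y => by
              simpa [hβr] using
                expSum_rpow_le_card_rpow_mul_exp (β := l / r) (by positivity) hr0.le
                  (innerCoords q y)
      _ = _ := integral_const_mul _ _
  have card_rpow_tendsto : Filter.Tendsto
      (fun r : ℝ => (Fintype.card ι : ℝ) ^ r *
        mgf (fun y => ⨆ k, inner ℝ (q k) y) (stdGaussian Y) l)
      (nhdsWithin 0 (Set.Ioi 0))
      (nhds (mgf (fun y => ⨆ k, inner ℝ (q k) y) (stdGaussian Y) l)) := by
    have hcont : Continuous fun r : ℝ => (Fintype.card ι : ℝ) ^ r :=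
      Real.continuous_const_rpow (Nat.cast_ne_zero.2 Fintype.card_ne_zero)
    simpa using ((hcont.tendsto 0).mono_left nhdsWithin_le_nhds).mul_const
      (mgf (fun y => ⨆ k, inner ℝ (q k) y) (stdGaussian Y) l)
  exact ge_of_tendsto card_rpow_tendsto
    (Filter.mem_of_superset (Ioc_mem_nhdsGT zero_lt_one) le_card_rpow_mul)

end Slepian

/-! ### Chevet's inequality -/

section Chevet

variable {X : Type*} [NormedAddCommGroup X] [InnerProductSpace ℝ X] [FiniteDimensional ℝ X]
  [MeasurableSpace X] [BorelSpace X]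
  {Y : Type*} [NormedAddCommGroup Y] [InnerProductSpace ℝ Y] [FiniteDimensional ℝ Y]
  {Z : Type*} [NormedAddCommGroup Z] [InnerProductSpace ℝ Z] [FiniteDimensional ℝ Z]

lemma stdGaussian_real : stdGaussian ℝ = gaussianReal 0 1 := by
  refine Measure.ext_of_charFun (funext fun t => ?_)
  rw [charFun_stdGaussian, charFun_gaussianReal, ← Complex.ofReal_pow, Real.norm_eq_abs, sq_abs]
  congr 1
  push_cast
  ring

lemma integral_exp_mul_stdGaussian_real (l : ℝ) :
    ∫ t : ℝ, Real.exp (l * t) ∂stdGaussian ℝ = Real.exp (l ^ 2 / 2) := by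
  simpa [mgf] using mgf_gaussianReal (X := id) (p := stdGaussian ℝ) (μ := 0) (v := 1)
    (by rw [Measure.map_id, stdGaussian_real]) l

section FiniteIndex

variable {ι : Type*} [Finite ι] [Nonempty ι]

lemma mgf_ciSup_inner_toLp_one (P : ι → X) (l : ℝ) :
    mgf (fun x : WithLp 2 (X × ℝ) => ⨆ k, inner ℝ (WithLp.toLp 2 (P k, (1 : ℝ))) x)
        (stdGaussian (WithLp 2 (X × ℝ))) l =
      mgf (fun x => ⨆ k, inner ℝ (P k) x) (stdGaussian X) l * Real.exp (l ^ 2 / 2) := by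
  have exp_ciSup : ∀ x : WithLp 2 (X × ℝ),
      Real.exp (l * ⨆ k, inner ℝ (WithLp.toLp 2 (P k, (1 : ℝ))) x) =
        Real.exp (l * ⨆ k, inner ℝ (P k) x.fst) * Real.exp (l * x.snd) := fun x => by
    rw [← Real.exp_add, ← mul_add, ciSup_add (Set.finite_range _).bddAbove]
    simp [WithLp.prod_inner_apply]
  simp only [mgf, exp_ciSup]
  rw [integral_mul_stdGaussian_prod (fun x => Real.exp (l * ⨆ k, inner ℝ (P k) x))
    fun t => Real.exp (l * t), integral_exp_mul_stdGaussian_real]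

variable [MeasurableSpace Y] [BorelSpace Y] [MeasurableSpace Z] [BorelSpace Z]

lemma mgf_ciSup_inner_toLp_le {z : ι → Y} {v : ι → Z} (hz : ∀ k, ‖z k‖ = 1)
    (hv : ∀ k, ‖v k‖ = 1) {l : ℝ} (hl : 0 ≤ l) :
    mgf (fun y => ⨆ k, inner ℝ (WithLp.toLp 2 (z k, v k)) y) (stdGaussian (WithLp 2 (Y × Z))) l ≤
      Real.exp (l * (√(Module.finrank ℝ Y) + √(Module.finrank ℝ Z)) + l ^ 2) := by
  have inner_le : ∀ k (y : WithLp 2 (Y × Z)),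
      inner ℝ (WithLp.toLp 2 (z k, v k)) y ≤ ‖y.fst‖ + ‖y.snd‖ := fun k y => by
    rw [WithLp.prod_inner_apply]
    refine add_le_add ?_ ?_
    · simpa [hz] using real_inner_le_norm (z k) y.fst
    · simpa [hv] using real_inner_le_norm (v k) y.snd
  have integrable_exp_norms : Integrable (fun y : WithLp 2 (Y × Z) =>
      Real.exp (l * ‖y.fst‖) * Real.exp (l * ‖y.snd‖)) (stdGaussian (WithLp 2 (Y × Z))) := by
    refine (integrable_exp_mul_norm_stdGaussian _ (l + l)).mono' (by fun_prop)
      (ae_of_all _ fun y => ?_)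
    rw [Real.norm_of_nonneg (by positivity), ← Real.exp_add, add_mul]
    have := WithLp.norm_fst_le (x := y)
    have := WithLp.norm_snd_le (x := y)
    gcongr
  calc mgf (fun y => ⨆ k, inner ℝ (WithLp.toLp 2 (z k, v k)) y) (stdGaussian (WithLp 2 (Y × Z))) l
      ≤ ∫ y, Real.exp (l * ‖y.fst‖) * Real.exp (l * ‖y.snd‖) ∂stdGaussian (WithLp 2 (Y × Z)) := by
        refine integral_mono (integrable_exp_mul_ciSup_inner l _) integrable_exp_norms fun y => ?_
        rw [← Real.exp_add, ← mul_add]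
        gcongr
        exact ciSup_le fun k => inner_le k y
    _ = (∫ y, Real.exp (l * ‖y‖) ∂stdGaussian Y) * ∫ y, Real.exp (l * ‖y‖) ∂stdGaussian Z :=
        integral_mul_stdGaussian_prod (fun y => Real.exp (l * ‖y‖)) fun y => Real.exp (l * ‖y‖)
    _ ≤ Real.exp (l * √(Module.finrank ℝ Y) + l ^ 2 / 2) *
          Real.exp (l * √(Module.finrank ℝ Z) + l ^ 2 / 2) := by
        gcongr <;> exact integral_exp_mul_norm_stdGaussian_le _ hl
    _ = Real.exp (l * (√(Module.finrank ℝ Y) + √(Module.finrank ℝ Z)) + l ^ 2) := by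
        rw [← Real.exp_add]; ring_nf

theorem mgf_ciSup_inner_stdGaussian_le_of_inner_eq_mul {P : ι → X} {z : ι → Y} {v : ι → Z}
    (hP : ∀ j k, inner ℝ (P j) (P k) = inner ℝ (z j) (z k) * inner ℝ (v j) (v k))
    (hz : ∀ k, ‖z k‖ = 1) (hv : ∀ k, ‖v k‖ = 1) {l : ℝ} (hl : 0 ≤ l) :
    mgf (fun x => ⨆ k, inner ℝ (P k) x) (stdGaussian X) l ≤
      Real.exp (l * (√(Module.finrank ℝ Y) + √(Module.finrank ℝ Z)) + l ^ 2 / 2) := by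
  have norm_P : ∀ k, ‖P k‖ = 1 := fun k => by
    rw [norm_eq_sqrt_real_inner, hP]
    simp [hz, hv]
  -- `(1 - ⟪zⱼ, zₖ⟫) (1 - ⟪vⱼ, vₖ⟫) ≥ 0` is the covariance comparison required by Slepian.
  have slepian := mgf_ciSup_inner_stdGaussian_le (p := fun k => WithLp.toLp 2 (P k, (1 : ℝ)))
    (q := fun k => WithLp.toLp 2 (z k, v k))
    (fun k => by simp [WithLp.prod_norm_eq_of_L2, norm_P, hz, hv])
    (fun j k => by
      have hzz : inner ℝ (z j) (z k) ≤ 1 := by simpa [hz] using real_inner_le_norm (z j) (z k)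
      have hvv : inner ℝ (v j) (v k) ≤ 1 := by simpa [hv] using real_inner_le_norm (v j) (v k)
      simp only [WithLp.prod_inner_apply, hP, real_inner_self_eq_norm_sq]
      norm_num
      nlinarith [mul_nonneg (sub_nonneg.2 hzz) (sub_nonneg.2 hvv)]) hl
  rw [mgf_ciSup_inner_toLp_one, ← le_div_iff₀ (Real.exp_pos _)] at slepian
  refine slepian.trans ((div_le_div_of_nonneg_right (mgf_ciSup_inner_toLp_le hz hv hl)
    (Real.exp_pos _).le).trans_eq ?_)
  rw [← Real.exp_sub]
  ring_nf

end FiniteIndex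

lemma measure_exists_lt_le_of_finset {Ω ι : Type*} [MeasurableSpace Ω] {μ : Measure Ω}
    [TopologicalSpace ι] [TopologicalSpace.SeparableSpace ι] {f : ι → Ω → ℝ}
    (hf : ∀ ω, Continuous fun k => f k ω) {a : ℝ} {ε : ℝ≥0∞}
    (h : ∀ F : Finset ι, μ {ω | ∃ k ∈ F, a < f k ω} ≤ ε) : μ {ω | ∃ k, a < f k ω} ≤ ε := by
  classical
  obtain ⟨D, hD, hD_dense⟩ := TopologicalSpace.exists_countable_dense ι
  have := hD.to_subtype
  have subset_iUnion : {ω | ∃ k, a < f k ω} ⊆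
      ⋃ F : Finset D, {ω | ∃ k ∈ F.map (.subtype _), a < f k ω} := by
    rintro ω ⟨k, hk⟩
    obtain ⟨d, hd, hdD⟩ := hD_dense.exists_mem_open (isOpen_lt continuous_const (hf ω)) ⟨k, hk⟩
    exact Set.mem_iUnion.2 ⟨{⟨d, hd⟩}, d, by simp, hdD⟩
  have directed : Directed (· ⊆ ·) fun F : Finset D =>
      {ω | ∃ k ∈ F.map (.subtype _), a < f k ω} :=
    Monotone.directed_le fun F G hFG ω ⟨k, hk, hkω⟩ => ⟨k, Finset.map_subset_map.2 hFG hk, hkω⟩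
  refine (measure_mono subset_iUnion).trans ?_
  rw [directed.measure_iUnion]
  exact iSup_le fun F => h _

theorem stdGaussian_exists_inner_gt_le {ι : Type*} [TopologicalSpace ι]
    [TopologicalSpace.SeparableSpace ι] {P : ι → X} {z : ι → Y} {v : ι → Z}
    (hPc : Continuous P)
    (hP : ∀ j k, inner ℝ (P j) (P k) = inner ℝ (z j) (z k) * inner ℝ (v j) (v k))
    (hz : ∀ k, ‖z k‖ = 1) (hv : ∀ k, ‖v k‖ = 1) {s : ℝ} (hs : 0 ≤ s) :
    stdGaussian X
      {x | ∃ k, √(Module.finrank ℝ Y) + √(Module.finrank ℝ Z) + s < inner ℝ (P k) x} ≤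
      ENNReal.ofReal (Real.exp (-s ^ 2 / 2)) := by
  borelize Y Z
  set D := √(Module.finrank ℝ Y) + √(Module.finrank ℝ Z)
  refine measure_exists_lt_le_of_finset (fun x => by fun_prop) fun F => ?_
  rcases F.eq_empty_or_nonempty with rfl | hF
  · simp
  have := hF.to_subtype
  have subset_ciSup : {x | ∃ k ∈ F, D + s < inner ℝ (P k) x} ⊆
      {x | D + s ≤ ⨆ k : F, inner ℝ (P k) x} := fun x ⟨k, hkF, hk⟩ =>
    hk.le.trans
      (le_ciSup (f := fun k : F => inner ℝ (P k) x) (Set.finite_range _).bddAbove ⟨k, hkF⟩)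
  rw [← ofReal_measureReal]
  refine ENNReal.ofReal_le_ofReal ?_
  calc (stdGaussian X).real {x | ∃ k ∈ F, D + s < inner ℝ (P k) x}
      ≤ (stdGaussian X).real {x | D + s ≤ ⨆ k : F, inner ℝ (P k) x} :=
        measureReal_mono subset_ciSup
    _ ≤ Real.exp (-s * (D + s)) * mgf (fun x => ⨆ k : F, inner ℝ (P k) x) (stdGaussian X) s :=
        measure_ge_le_exp_mul_mgf _ hs (integrable_exp_mul_ciSup_inner s _)
    _ ≤ Real.exp (-s * (D + s)) * Real.exp (s * D + s ^ 2 / 2) := by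
        gcongr
        exact mgf_ciSup_inner_stdGaussian_le_of_inner_eq_mul
          (fun j k : F => hP j k) (fun k => hz k) (fun k => hv k) hs
    _ = Real.exp (-s ^ 2 / 2) := by rw [← Real.exp_add]; ring_nf

theorem stdGaussian_exists_inner_bilin_gt_le (Φ : Y →ₗ[ℝ] Z →ₗ[ℝ] X)
    (hΦ : ∀ z z' v v', inner ℝ (Φ z v) (Φ z' v') = inner ℝ z z' * inner ℝ v v')
    {s : ℝ} (hs : 0 ≤ s) :
    stdGaussian X {x | ∃ z v, (√(Module.finrank ℝ Y) + √(Module.finrank ℝ Z) + s) *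
      (‖z‖ * ‖v‖) < inner ℝ (Φ z v) x} ≤ ENNReal.ofReal (Real.exp (-s ^ 2 / 2)) := by
  have hcont : Continuous fun k : Metric.sphere (0 : Y) 1 × Metric.sphere (0 : Z) 1 =>
      Φ k.1 k.2 := by
    have : Continuous fun k : Metric.sphere (0 : Y) 1 × Metric.sphere (0 : Z) 1 =>
      Φ.toContinuousBilinearMap k.1 k.2 := by fun_prop
    simpa using this
  refine (measure_mono ?_).trans (stdGaussian_exists_inner_gt_le hcont
    (fun j k => hΦ j.1 k.1 j.2 k.2) (fun k => norm_eq_of_mem_sphere k.1)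
    (fun k => norm_eq_of_mem_sphere k.2) hs)
  rintro x ⟨z, v, hzv⟩
  have hz : z ≠ 0 := by rintro rfl; simp at hzv
  have hv : v ≠ 0 := by rintro rfl; simp at hzv
  refine ⟨⟨⟨‖z‖⁻¹ • z, by simp [norm_smul, hz]⟩, ⟨‖v‖⁻¹ • v, by simp [norm_smul, hv]⟩⟩, ?_⟩
  have := norm_pos_iff.2 hz
  have := norm_pos_iff.2 hv
  simp only [map_smul, LinearMap.smul_apply, real_inner_smul_left]
  rwa [← mul_assoc, ← mul_inv, inv_mul_eq_div, lt_div_iff₀ (by positivity), mul_comm ‖v‖]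

end Chevet

/-! ### Inverse quadratic forms -/

section InvQuadForm

variable {n : Type} [Fintype n] [DecidableEq n] {M : Matrix n n ℝ}

lemma sum_dotProduct_smul_eigenvectorBasis (hM : M.IsHermitian) (v : n → ℝ) :
    ∑ j, ((hM.eigenvectorBasis j).ofLp ⬝ᵥ v) • (hM.eigenvectorBasis j).ofLp = v := by
  have := congrArg WithLp.ofLp (hM.eigenvectorBasis.sum_repr' (WithLp.toLp 2 v))
  simpa only [WithLp.ofLp_sum, WithLp.ofLp_smul, EuclideanSpace.inner_eq_star_dotProduct,
    star_trivial, dotProduct_comm v] using this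

lemma eigenvectorBasis_dotProduct_mulVec (hM : M.IsHermitian) (v : n → ℝ) (j : n) :
    (hM.eigenvectorBasis j).ofLp ⬝ᵥ (M *ᵥ v) =
      hM.eigenvalues j * ((hM.eigenvectorBasis j).ofLp ⬝ᵥ v) := by
  have hMT : Mᵀ = M := by simpa [Matrix.IsHermitian] using hM
  rw [Matrix.dotProduct_mulVec, ← Matrix.mulVec_transpose, hMT, hM.mulVec_eigenvectorBasis,
    smul_dotProduct, smul_eq_mul]

lemma dotProduct_mulVec_eq_sum_eigenvalues (hM : M.IsHermitian) (v : n → ℝ) :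
    v ⬝ᵥ (M *ᵥ v) = ∑ j, hM.eigenvalues j * ((hM.eigenvectorBasis j).ofLp ⬝ᵥ v) ^ 2 := by
  nth_rw 1 [← sum_dotProduct_smul_eigenvectorBasis hM v]
  rw [sum_dotProduct]
  refine Finset.sum_congr rfl fun j _ => ?_
  rw [smul_dotProduct, eigenvectorBasis_dotProduct_mulVec, smul_eq_mul]
  ring

lemma invQuadForm_mulVec (hM : M.PosSemidef) (u : n → ℝ) :
    invQuadForm hM.isHermitian (M *ᵥ u) = ENNReal.ofReal (u ⬝ᵥ (M *ᵥ u)) := by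
  have eigenvalue_nonneg := hM.eigenvalues_nonneg
  rw [dotProduct_mulVec_eq_sum_eigenvalues hM.isHermitian, invQuadForm,
    ENNReal.ofReal_sum_of_nonneg fun j _ => mul_nonneg (eigenvalue_nonneg j) (sq_nonneg _)]
  refine Finset.sum_congr rfl fun j _ => ?_
  rw [eigenvectorBasis_dotProduct_mulVec]
  rcases (eigenvalue_nonneg j).eq_or_lt with h | h
  · simp [← h]
  · rw [← ENNReal.ofReal_inv_of_pos h, ← ENNReal.ofReal_mul (inv_nonneg.2 h.le)]
    congr 1
    field_simp

lemma eigenvectorBasis_dotProduct_eq_zero_of_invQuadForm_ne_top (hM : M.IsHermitian) {v : n → ℝ}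
    (hv : invQuadForm hM v ≠ ∞) {j : n} (hj : hM.eigenvalues j = 0) :
    (hM.eigenvectorBasis j).ofLp ⬝ᵥ v = 0 := by
  by_contra hne
  refine hv (ENNReal.sum_eq_top.2 ⟨j, Finset.mem_univ j, ?_⟩)
  rw [hj, ENNReal.ofReal_zero, ENNReal.inv_zero, ENNReal.top_mul]
  exact (ENNReal.ofReal_pos.2 (sq_pos_of_ne_zero hne)).ne'

lemma exists_mulVec_eq_of_invQuadForm_ne_top (hM : M.IsHermitian) {v : n → ℝ}
    (hv : invQuadForm hM v ≠ ∞) : ∃ u, M *ᵥ u = v := by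
  refine ⟨∑ j, ((hM.eigenvalues j)⁻¹ * ((hM.eigenvectorBasis j).ofLp ⬝ᵥ v)) •
    (hM.eigenvectorBasis j).ofLp, ?_⟩
  conv_rhs => rw [← sum_dotProduct_smul_eigenvectorBasis hM v]
  rw [Matrix.mulVec_sum]
  refine Finset.sum_congr rfl fun j _ => ?_
  rw [Matrix.mulVec_smul, hM.mulVec_eigenvectorBasis, smul_smul]
  by_cases hj : hM.eigenvalues j = 0
  · simp [eigenvectorBasis_dotProduct_eq_zero_of_invQuadForm_ne_top hM hv hj]
  · field_simp

end InvQuadForm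

/-! ### Least squares -/

section LeastSquares

variable {τ m n : Type*} [Fintype m] [Fintype n]

section Outer

variable {V : Type*} [NormedAddCommGroup V] [InnerProductSpace ℝ V]

/-- The bilinear map sending `z` and `v` to the rank-one matrix `z vᵀ`, stored by rows. -/
noncomputable def outer : EuclideanSpace ℝ τ →ₗ[ℝ] V →ₗ[ℝ] PiLp 2 fun _ : τ => V :=
  LinearMap.mk₂ ℝ (fun z v => WithLp.toLp 2 fun t => z t • v)
    (fun _ _ _ => by ext1 t; simp [add_smul])
    (fun _ _ _ => by ext1 t; simp [mul_smul])
    (fun _ _ _ => by ext1 t; simp [smul_add])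
    (fun _ _ _ => by ext1 t; exact smul_comm _ _ _)

end Outer

/-- The values `θ yₜ` predicted by the parameter matrix `θ`, where `yₜ` is the `t`-th row of the
design matrix `Y`. -/
noncomputable def fitted (Y : Matrix τ n ℝ) :
    Matrix m n ℝ →ₗ[ℝ] PiLp 2 fun _ : τ => EuclideanSpace ℝ m where
  toFun θ := WithLp.toLp 2 fun t => WithLp.toLp 2 (θ *ᵥ Y t)
  map_add' θ θ' := by ext; simp [Matrix.add_mulVec]
  map_smul' c θ := by ext; simp [Matrix.smul_mulVec]

lemma outer_mulVec_eq_fitted (Y : Matrix τ n ℝ) (u : n → ℝ) (v : EuclideanSpace ℝ m) :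
    outer (WithLp.toLp 2 (Y *ᵥ u)) v = fitted Y (Matrix.vecMulVec v.ofLp u) := by
  ext t k
  simp [outer, fitted, Matrix.vecMulVec_mulVec, Matrix.mulVec, dotProduct_comm u]

lemma fitted_mul_transpose (Y : Matrix τ n ℝ) (S : Matrix n n ℝ) (θ : Matrix m n ℝ) :
    fitted (Y * Sᵀ) θ = fitted Y (θ * S) := by
  have row_eq : ∀ t, (Y * Sᵀ) t = S *ᵥ Y t := fun t => by
    rw [← Matrix.vecMul_transpose]; rfl
  ext t k
  simp [fitted, row_eq]

lemma norm_toLp_mulVec_sq (A : Matrix m n ℝ) (v : n → ℝ) :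
    ‖WithLp.toLp 2 (A *ᵥ v)‖ ^ 2 = v ⬝ᵥ ((Aᵀ * A) *ᵥ v) := by
  rw [← real_inner_self_eq_norm_sq, EuclideanSpace.inner_toLp_toLp, star_trivial,
    ← Matrix.mulVec_mulVec, Matrix.mulVec_transpose, dotProduct_comm v, Matrix.dotProduct_mulVec]

variable [Fintype τ]

section Outer

variable {V : Type*} [NormedAddCommGroup V] [InnerProductSpace ℝ V]

lemma inner_outer (z : EuclideanSpace ℝ τ) (v : V) (W : PiLp 2 fun _ : τ => V) :
    inner ℝ (outer z v) W = ∑ t, z t * inner ℝ v (W t) := by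
  simp [outer, PiLp.inner_apply, real_inner_smul_left]

lemma inner_outer_outer (z z' : EuclideanSpace ℝ τ) (v v' : V) :
    inner ℝ (outer z v) (outer z' v') = inner ℝ z z' * inner ℝ v v' := by
  rw [inner_outer, PiLp.inner_apply, Finset.sum_mul]
  refine Finset.sum_congr rfl fun t _ => ?_
  simp [outer, real_inner_smul_right]
  ring

/-- The noise `W`, viewed as a bilinear form through `outer`, has norm at most `κ` on the column
space of the design matrix `Y`. -/
def NoiseBounded (Y : Matrix τ n ℝ) (W : PiLp 2 fun _ : τ => V) (κ : ℝ) : Prop :=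
  ∀ u v, inner ℝ (outer (WithLp.toLp 2 (Y *ᵥ u)) v) W ≤ κ * (‖WithLp.toLp 2 (Y *ᵥ u)‖ * ‖v‖)

end Outer

lemma inner_outer_fitted (Y : Matrix τ n ℝ) (u : n → ℝ) (v : EuclideanSpace ℝ m)
    (Δ : Matrix m n ℝ) : inner ℝ (outer (WithLp.toLp 2 (Y *ᵥ u)) v) (fitted Y Δ) =
      inner ℝ v (WithLp.toLp 2 (Δ *ᵥ ((Yᵀ * Y) *ᵥ u))) := by
  have gram_mulVec : (Yᵀ * Y) *ᵥ u = ∑ t, (Y *ᵥ u) t • Y t := by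
    rw [← Matrix.mulVec_mulVec, Matrix.mulVec_transpose, Matrix.vecMul_eq_sum]
  rw [inner_outer, gram_mulVec, Matrix.mulVec_sum, WithLp.toLp_sum, inner_sum]
  refine Finset.sum_congr rfl fun t _ => ?_
  rw [Matrix.mulVec_smul, WithLp.toLp_smul, real_inner_smul_right]
  rfl

/-- `θ` minimises the least-squares cost `∑ₜ ‖zₜ - θ yₜ‖²`, where `yₜ` is the `t`-th row of the
design matrix `Y`. -/
def IsLeastSquares (Y : Matrix τ n ℝ) (z : PiLp 2 fun _ : τ => EuclideanSpace ℝ m)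
    (θ : Matrix m n ℝ) : Prop :=
  ∀ θ', ‖z - fitted Y θ‖ ≤ ‖z - fitted Y θ'‖

lemma IsLeastSquares.inner_residual_fitted_eq_zero {Y : Matrix τ n ℝ}
    {z : PiLp 2 fun _ : τ => EuclideanSpace ℝ m} {θ : Matrix m n ℝ} (h : IsLeastSquares Y z θ)
    (θ' : Matrix m n ℝ) : inner ℝ (z - fitted Y θ) (fitted Y θ') = 0 := by
  set K := LinearMap.range (fitted (m := m) Y)
  have norm_eq_iInf : ‖z - fitted Y θ‖ = ⨅ w : K, ‖z - w‖ := by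
    refine le_antisymm (le_ciInf ?_)
      (ciInf_le (f := fun w : K => ‖z - w‖) ⟨0, ?_⟩ ⟨fitted Y θ, θ, rfl⟩)
    · rintro ⟨_, θ', rfl⟩
      exact h θ'
    · rintro _ ⟨w, rfl⟩
      exact norm_nonneg _
  exact (K.norm_eq_iInf_iff_real_inner_eq_zero (LinearMap.mem_range_self _ θ)).1 norm_eq_iInf _
    (LinearMap.mem_range_self _ θ')

theorem IsLeastSquares.norm_error_mulVec_gram_le {Y : Matrix τ n ℝ} {θhat θ : Matrix m n ℝ}
    {W : PiLp 2 fun _ : τ => EuclideanSpace ℝ m} (h : IsLeastSquares Y (fitted Y θ + W) θhat)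
    {κ : ℝ} (hκ : 0 ≤ κ) (hW : NoiseBounded Y W κ) (u : n → ℝ) :
    ‖WithLp.toLp 2 ((θhat - θ) *ᵥ ((Yᵀ * Y) *ᵥ u))‖ ≤ κ * ‖WithLp.toLp 2 (Y *ᵥ u)‖ := by
  set e : EuclideanSpace ℝ m := WithLp.toLp 2 ((θhat - θ) *ᵥ ((Yᵀ * Y) *ᵥ u)) with he
  have residual_eq : fitted Y θ + W - fitted Y θhat = W - fitted Y (θhat - θ) := by
    rw [map_sub]; abel
  have norm_sq_eq : ‖e‖ ^ 2 = inner ℝ (outer (WithLp.toLp 2 (Y *ᵥ u)) e) W := by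
    have normal := h.inner_residual_fitted_eq_zero (Matrix.vecMulVec e.ofLp u)
    rw [residual_eq, ← outer_mulVec_eq_fitted, real_inner_comm, inner_sub_right,
      inner_outer_fitted, ← he, real_inner_self_eq_norm_sq] at normal
    linarith
  have bound := norm_sq_eq.trans_le (hW u e)
  rcases (norm_nonneg e).eq_or_lt with h0 | hpos
  · rw [← h0]; positivity
  · exact le_of_mul_le_mul_right (by linarith) hpos

lemma IsLeastSquares.mul_right [DecidableEq n] {Y : Matrix τ n ℝ} {S : Matrix n n ℝ}
    {z : PiLp 2 fun _ : τ => EuclideanSpace ℝ m} {θ : Matrix m n ℝ}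
    (h : IsLeastSquares (Y * Sᵀ) z θ) (hS : IsUnit S.det) : IsLeastSquares Y z (θ * S) := by
  intro θ'
  simpa only [fitted_mul_transpose, Matrix.nonsing_inv_mul_cancel_right _ _ hS] using h (θ' * S⁻¹)

theorem IsLeastSquares.loewnerLEInv {n : Type} [Fintype n] [DecidableEq n] {Y : Matrix τ n ℝ}
    {θhat θ : Matrix m n ℝ} {W : PiLp 2 fun _ : τ => EuclideanSpace ℝ m}
    (h : IsLeastSquares Y (fitted Y θ + W) θhat) {κ : ℝ} (hκ : 0 ≤ κ) (hW : NoiseBounded Y W κ)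
    (hY : (Yᵀ * Y).IsHermitian) :
    LoewnerLEInv ((θhat - θ)ᵀ * (θhat - θ)) (κ ^ 2) hY := by
  intro v hv
  obtain ⟨u, rfl⟩ := exists_mulVec_eq_of_invQuadForm_ne_top hY hv
  have gram_posSemidef : (Yᵀ * Y).PosSemidef := by
    simpa using Matrix.posSemidef_conjTranspose_mul_self Y
  rw [invQuadForm_mulVec gram_posSemidef, ← ENNReal.ofReal_mul (sq_nonneg κ),
    ← norm_toLp_mulVec_sq, ← norm_toLp_mulVec_sq, ← mul_pow]
  gcongr
  exact h.norm_error_mulVec_gram_le hκ hW u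

end LeastSquares

/-! ### The affine system -/

section AffineSystem

variable {nx T : ℕ}

/-- The design matrix of the affine system, with rows `(xₜ, 1)`. -/
def design (x : Fin T → EuclideanSpace ℝ (Fin nx)) : Matrix (Fin T) (Fin nx ⊕ Unit) ℝ :=
  Matrix.of fun t => regressor (x t)

/-- The diagonal matrix `diag(σx, …, σx, 1)` converting the regressor `(x / σx, 1)` into
`(x, 1)`. -/
def scaling (nx : ℕ) (σx : ℝ) : Matrix (Fin nx ⊕ Unit) (Fin nx ⊕ Unit) ℝ :=
  Matrix.diagonal (Sum.elim (fun _ => σx) fun _ => 1)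

lemma isUnit_det_scaling {σx : ℝ} (hσx : σx ≠ 0) : IsUnit (scaling nx σx).det := by
  simp [scaling, hσx]

lemma design_eq_mul_scaling {σx : ℝ} (hσx : σx ≠ 0) (x : Fin T → EuclideanSpace ℝ (Fin nx)) :
    design x = design (σx⁻¹ • x) * (scaling nx σx)ᵀ := by
  ext t (i | i) <;> simp [design, scaling, regressor, Matrix.mul_diagonal, mul_right_comm, hσx]

lemma dataMatrix_eq (σx : ℝ) (x : Fin T → EuclideanSpace ℝ (Fin nx)) :
    dataMatrix σx x = (design (σx⁻¹ • x))ᵀ * design (σx⁻¹ • x) := by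
  ext (i | i) (j | j) <;>
    simp [dataMatrix, design, regressor, Matrix.mul_apply, Matrix.sum_apply,
      Matrix.vecMulVec_apply, mul_assoc, mul_left_comm]

lemma stackedError_mul_transpose (σx : ℝ) (θhat θ : Matrix (Fin nx) (Fin nx ⊕ Unit) ℝ) :
    stackedError σx θhat θ * (stackedError σx θhat θ)ᵀ =
      (θhat * scaling nx σx - θ * scaling nx σx)ᵀ *
        (θhat * scaling nx σx - θ * scaling nx σx) := by
  have transpose_eq : ((θhat - θ) * scaling nx σx)ᵀ = stackedError σx θhat θ := by
    rw [Matrix.transpose_mul, scaling, Matrix.diagonal_transpose]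
    -- The product in `stackedError` is elaborated with the multiplication of `CStarMatrix`.
    rfl
  rw [← Matrix.sub_mul, ← transpose_eq, Matrix.transpose_transpose]

lemma toLp_affineStep (B : Matrix (Fin nx) (Fin nx) ℝ) (b : Fin nx → ℝ)
    (x w : Fin T → EuclideanSpace ℝ (Fin nx)) :
    WithLp.toLp 2 (fun t => affineStep B b (x t) (w t)) =
      fitted (design x) (param B b) + WithLp.toLp 2 w := by
  ext t k
  simp [affineStep, fitted, design, param, regressor, Matrix.fromCols_mulVec, Matrix.mulVec,
    dotProduct, add_comm]

lemma IsOLS.isLeastSquares {x z : Fin T → EuclideanSpace ℝ (Fin nx)}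
    {θ : Matrix (Fin nx) (Fin nx ⊕ Unit) ℝ} (h : IsOLS x z θ) :
    IsLeastSquares (design x) (WithLp.toLp 2 z) θ := by
  have lsCost_eq : ∀ θ, lsCost x z θ = ‖WithLp.toLp 2 z - fitted (design x) θ‖ ^ 2 := fun θ => by
    rw [PiLp.norm_sq_eq_of_L2]
    rfl
  intro θ'
  have := h θ'
  rwa [lsCost_eq, lsCost_eq, sq_le_sq₀ (norm_nonneg _) (norm_nonneg _)] at this

theorem IsOLS.loewnerLEInv {σx κ : ℝ} (hσx : σx ≠ 0) (hκ : 0 ≤ κ)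
    {B : Matrix (Fin nx) (Fin nx) ℝ} {b : Fin nx → ℝ}
    {x w : Fin T → EuclideanSpace ℝ (Fin nx)}
    (hw : NoiseBounded (design (σx⁻¹ • x)) (WithLp.toLp 2 w) κ)
    {θhat : Matrix (Fin nx) (Fin nx ⊕ Unit) ℝ}
    (hθ : IsOLS x (fun t => affineStep B b (x t) (w t)) θhat) :
    LoewnerLEInv (stackedError σx θhat (param B b) * (stackedError σx θhat (param B b))ᵀ)
      (κ ^ 2) (dataMatrix_isHermitian σx x) := by
  have scaled := hθ.isLeastSquares
  rw [toLp_affineStep, design_eq_mul_scaling hσx x, fitted_mul_transpose] at scaled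
  have bound := (scaled.mul_right (isUnit_det_scaling hσx)).loewnerLEInv hκ hw
  rw [← dataMatrix_eq, ← stackedError_mul_transpose] at bound
  exact bound _

end AffineSystem

/-! ### The Gaussian noise -/

section GaussianNoise

variable {τ n V : Type*} [Fintype τ] [NormedAddCommGroup V] [InnerProductSpace ℝ V]
  [FiniteDimensional ℝ V] [MeasurableSpace V] [BorelSpace V]

theorem stdGaussian_not_noiseBounded_le [Fintype n] (Y : Matrix τ n ℝ) {σ s : ℝ} (hσ : 0 ≤ σ)
    (hs : 0 ≤ s) :
    stdGaussian (PiLp 2 fun _ : τ => V) {W | ¬ NoiseBounded Y (σ • W)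
      (σ * (√(Fintype.card n) + √(Module.finrank ℝ V) + s))} ≤
      ENNReal.ofReal (Real.exp (-s ^ 2 / 2)) := by
  set toColumns : (n → ℝ) →ₗ[ℝ] EuclideanSpace ℝ τ :=
    (WithLp.linearEquiv 2 ℝ (τ → ℝ)).symm.toLinearMap ∘ₗ Y.mulVecLin
  set K := LinearMap.range toColumns
  have finrank_K_le : Module.finrank ℝ K ≤ Fintype.card n := by
    simpa using toColumns.finrank_range_le
  refine (measure_mono ?_).trans (stdGaussian_exists_inner_bilin_gt_le
    ((outer (V := V)).comp K.subtype)
    (fun z z' => inner_outer_outer (z : EuclideanSpace ℝ τ) z') hs)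
  intro W hW
  simp only [NoiseBounded, Set.mem_ofPred_eq, not_forall, not_le] at hW
  obtain ⟨u, v, huv⟩ := hW
  refine ⟨⟨WithLp.toLp 2 (Y *ᵥ u), u, rfl⟩, v, ?_⟩
  rw [inner_smul_right, mul_assoc] at huv
  refine lt_of_le_of_lt ?_ (lt_of_mul_lt_mul_left huv hσ)
  simp only [Submodule.coe_norm]
  gcongr

lemma multivariateGaussian_zero_sq_smul_one {ι : Type*} [Fintype ι] [DecidableEq ι] (σ : ℝ) :
    multivariateGaussian 0 (σ ^ 2 • (1 : Matrix ι ι ℝ)) =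
      (stdGaussian (EuclideanSpace ℝ ι)).map (σ • ·) := by
  have : IsProbabilityMeasure ((stdGaussian (EuclideanSpace ℝ ι)).map (σ • ·)) :=
    Measure.isProbabilityMeasure_map (by fun_prop)
  refine Measure.ext_of_charFun (funext fun t => ?_)
  have dotProduct_self : t.ofLp ⬝ᵥ t.ofLp = ‖t‖ ^ 2 := by
    simp only [EuclideanSpace.real_norm_sq_eq, dotProduct, ← sq]
  rw [charFun_multivariateGaussian (Matrix.PosSemidef.one.smul (sq_nonneg σ)), charFun_map_smul,
    charFun_stdGaussian, Matrix.smul_mulVec, Matrix.one_mulVec, dotProduct_smul, norm_smul,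
    dotProduct_self, ← Complex.ofReal_pow, mul_pow, Real.norm_eq_abs, sq_abs]
  simp [neg_div]

variable (τ V) in
lemma pi_stdGaussian :
    Measure.pi (fun _ : τ => stdGaussian V) =
      (stdGaussian (PiLp 2 fun _ : τ => V)).map WithLp.ofLp := by
  have : IsProbabilityMeasure ((stdGaussian (PiLp 2 fun _ : τ => V)).map WithLp.ofLp) :=
    Measure.isProbabilityMeasure_map (by fun_prop)
  refine (charFun_eq_pi_iff.1 fun t => ?_).symm
  rw [Measure.map_map (by fun_prop) (by fun_prop),
    show WithLp.toLp 2 ∘ WithLp.ofLp = (id : (PiLp 2 fun _ : τ => V) → _) from rfl,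
    Measure.map_id, charFun_stdGaussian, ← Complex.ofReal_pow, PiLp.norm_sq_eq_of_L2]
  simp_rw [charFun_stdGaussian]
  rw [← Complex.exp_sum, ← Finset.sum_div, Finset.sum_neg_distrib]
  push_cast
  rfl

variable {Ω : Type*} [MeasurableSpace Ω] {μ : Measure Ω}

theorem map_toLp_of_iIndepFun_multivariateGaussian {ι : Type*} [Fintype ι] [DecidableEq ι] {σ : ℝ}
    {w : τ → Ω → EuclideanSpace ℝ ι} (hw_indep : iIndepFun w μ)
    (hw_law : ∀ t, HasLaw (w t) (multivariateGaussian 0 (σ ^ 2 • 1)) μ) :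
    μ.map (fun ω => WithLp.toLp 2 fun t => w t ω) =
      (stdGaussian (PiLp 2 fun _ : τ => EuclideanSpace ℝ ι)).map (σ • ·) := by
  have : IsProbabilityMeasure μ := hw_indep.isProbabilityMeasure
  have hw_meas t := (hw_law t).aemeasurable
  have map_pi : μ.map (fun ω t => w t ω) =
      (stdGaussian (PiLp 2 fun _ : τ => EuclideanSpace ℝ ι)).map fun W t => σ • W t := by
    rw [(iIndepFun_iff_map_fun_eq_pi_map hw_meas).1 hw_indep]
    simp_rw [(hw_law _).map_eq, multivariateGaussian_zero_sq_smul_one]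
    rw [← Measure.pi_map_pi fun _ => by fun_prop, pi_stdGaussian,
      Measure.map_map (by fun_prop) (by fun_prop)]
    rfl
  have map_map := congrArg (Measure.map (WithLp.toLp 2)) map_pi
  rwa [AEMeasurable.map_map_of_aemeasurable (by fun_prop) (aemeasurable_pi_lambda _ hw_meas),
    Measure.map_map (by fun_prop) (by fun_prop)] at map_map

lemma measure_prodMk_preimage_le_of_indepFun [IsProbabilityMeasure μ] {α β : Type*}
    [MeasurableSpace α] [MeasurableSpace β] {X : Ω → α} {W : Ω → β} (hX : Measurable X)
    (hW : Measurable W) (hXW : IndepFun X W μ) {A : Set (α × β)} (hA : MeasurableSet A) {ε : ℝ≥0∞}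
    (hε : ∀ a, μ.map W (Prod.mk a ⁻¹' A) ≤ ε) : μ ((fun ω => (X ω, W ω)) ⁻¹' A) ≤ ε := by
  have := Measure.isProbabilityMeasure_map (μ := μ) hX.aemeasurable
  rw [← Measure.map_apply (hX.prodMk hW) hA,
    (indepFun_iff_map_prod_eq_prod_map_map hX.aemeasurable hW.aemeasurable).1 hXW,
    Measure.prod_apply hA]
  exact (lintegral_mono hε).trans (by simp)

variable {α : Type*} [TopologicalSpace α] [MeasurableSpace α] [OpensMeasurableSpace α]

variable (V) in
lemma measurableSet_noiseBounded [Fintype n] {Y : α → Matrix τ n ℝ} (hY : Continuous Y) (κ : ℝ) :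
    MeasurableSet {p : α × (PiLp 2 fun _ : τ => V) | NoiseBounded (Y p.1) p.2 κ} := by
  refine IsClosed.measurableSet ?_
  simp only [NoiseBounded, inner_outer, Set.ofPred_forall]
  refine isClosed_iInter fun u => isClosed_iInter fun v => isClosed_le ?_ ?_ <;> fun_prop

theorem exists_measurableSet_noiseBounded {ι : Type*} [Fintype ι] [DecidableEq ι] [Fintype n]
    {Y : α → Matrix τ n ℝ} (hY : Continuous Y) {x : Ω → α} (hx : Measurable x)
    {w : τ → Ω → EuclideanSpace ℝ ι} (hw : ∀ t, Measurable (w t)) (hw_indep : iIndepFun w μ)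
    {σ : ℝ} (hσ : 0 ≤ σ) (hw_law : ∀ t, HasLaw (w t) (multivariateGaussian 0 (σ ^ 2 • 1)) μ)
    (hxw_indep : IndepFun x (fun ω t => w t ω) μ) {s : ℝ} (hs : 0 ≤ s) :
    ∃ G, MeasurableSet G ∧ 1 - Real.exp (-s ^ 2 / 2) ≤ μ.real G ∧
      ∀ ω ∈ G, NoiseBounded (Y (x ω)) (WithLp.toLp 2 fun t => w t ω)
        (σ * (√(Fintype.card n) + √(Fintype.card ι) + s)) := by
  have : IsProbabilityMeasure μ := hw_indep.isProbabilityMeasure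
  set W : Ω → PiLp 2 fun _ : τ => EuclideanSpace ℝ ι := fun ω => WithLp.toLp 2 fun t => w t ω
  have hW : Measurable W := by fun_prop
  have hxW : IndepFun x W μ :=
    hxw_indep.comp measurable_id (by fun_prop : Measurable (WithLp.toLp 2))
  set κ := σ * (√(Fintype.card n) + √(Fintype.card ι) + s)
  set N := {p : α × (PiLp 2 fun _ : τ => EuclideanSpace ℝ ι) | NoiseBounded (Y p.1) p.2 κ}
  have hN : MeasurableSet N := measurableSet_noiseBounded _ hY κ
  have hG : MeasurableSet ((fun ω => (x ω, W ω)) ⁻¹' N) := (hx.prodMk hW) hN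
  refine ⟨_, hG, ?_, fun ω hω => hω⟩
  have measure_compl_le : μ ((fun ω => (x ω, W ω)) ⁻¹' N)ᶜ ≤
      ENNReal.ofReal (Real.exp (-s ^ 2 / 2)) := by
    refine measure_prodMk_preimage_le_of_indepFun hx hW hxW hN.compl fun a => ?_
    rw [map_toLp_of_iIndepFun_multivariateGaussian hw_indep hw_law,
      Measure.map_apply (by fun_prop) (measurable_prodMk_left hN.compl)]
    have := stdGaussian_not_noiseBounded_le (V := EuclideanSpace ℝ ι) (Y a) hσ hs
    rwa [finrank_euclideanSpace] at this
  have := ENNReal.toReal_le_of_le_ofReal (Real.exp_pos _).le measure_compl_le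
  rw [← measureReal_def, probReal_compl_eq_one_sub hG] at this
  linarith

end GaussianNoise

lemma continuous_design {nx T : ℕ} :
    Continuous (design : (Fin T → EuclideanSpace ℝ (Fin nx)) → _) := by
  refine continuous_matrix fun t i => ?_
  rcases i with i | i <;> simp only [design, regressor, Matrix.of_apply, Sum.elim_inl,
    Sum.elim_inr] <;> fun_prop

lemma exp_neg_sq_sqrt_two_mul_log_div_two {r : ℝ} (hr : 1 ≤ r) :
    Real.exp (-√(2 * Real.log r) ^ 2 / 2) = r⁻¹ := by
  rw [Real.sq_sqrt (mul_nonneg zero_le_two (Real.log_nonneg hr)), neg_div,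
    mul_div_cancel_left₀ _ two_ne_zero, Real.exp_neg, Real.exp_log (one_pos.trans_le hr)]

end BilinearId

theorem mainTheorem5_general {nx nu : ℕ} {Ω : Type*} [MeasurableSpace Ω]
    (μ : Measure Ω) [IsProbabilityMeasure μ]
    (B₀ : Matrix (Fin nx) (Fin nu) ℝ) (B : Fin nu → Matrix (Fin nx) (Fin nx) ℝ) (i : Fin nu)
    (σw σx δ : ℝ) (hσw : 0 ≤ σw) (hσx : σx ≠ 0) (hδ : δ ∈ Set.Ioo (0 : ℝ) 1)
    (T : ℕ) (x w : Fin T → Ω → EuclideanSpace ℝ (Fin nx))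
    (hx_meas : ∀ t, Measurable (x t)) (hw_meas : ∀ t, Measurable (w t))
    (hw_indep : iIndepFun w μ)
    (hw_law : ∀ t, HasLaw (w t) (multivariateGaussian 0 (σw ^ 2 • 1)) μ)
    (hxw_indep : IndepFun (fun ω t => x t ω) (fun ω t => w t ω) μ) :
    ∃ G : Set Ω, MeasurableSet G ∧ 1 - δ / (2 * nu) ≤ μ.real G ∧
      ∀ ω ∈ G, ∀ θhat : Matrix (Fin nx) (Fin nx ⊕ Unit) ℝ,
        BilinearId.IsOLS (fun t => x t ω)
          (fun t => BilinearId.affineStep (B i) (B₀.col i) (x t ω) (w t ω)) θhat →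
        BilinearId.LoewnerLEInv
          (BilinearId.stackedError σx θhat (BilinearId.param (B i) (B₀.col i)) *
            (BilinearId.stackedError σx θhat (BilinearId.param (B i) (B₀.col i)))ᵀ)
          (BilinearId.C₁ σw nx nu δ)
          (BilinearId.dataMatrix_isHermitian σx (fun t => x t ω)) := by
  have one_le_ratio : 1 ≤ 2 * (nu : ℝ) / δ := by
    have : (1 : ℝ) ≤ nu := mod_cast i.pos
    rw [one_le_div hδ.1]
    linarith [hδ.2]
  obtain ⟨G, hG, le_measure_G, noiseBounded_of_mem⟩ := BilinearId.exists_measurableSet_noiseBounded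
    (BilinearId.continuous_design.comp (continuous_const_smul σx⁻¹))
    (measurable_pi_lambda _ hx_meas) hw_meas hw_indep hσw hw_law hxw_indep
    (Real.sqrt_nonneg (2 * Real.log (2 * nu / δ)))
  refine ⟨G, hG, ?_, fun ω hω θhat hθ => ?_⟩
  · rwa [BilinearId.exp_neg_sq_sqrt_two_mul_log_div_two one_le_ratio, inv_div] at le_measure_G
  · have bound := hθ.loewnerLEInv hσx (by positivity) (noiseBounded_of_mem ω hω)
    simpa [BilinearId.C₁, mul_pow] using bound

theorem mainTheorem5 {nx nu : ℕ} {Ω : Type*} [MeasurableSpace Ω]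
    (μ : Measure Ω) [IsProbabilityMeasure μ]
    (B₀ : Matrix (Fin nx) (Fin nu) ℝ) (B : Fin nu → Matrix (Fin nx) (Fin nx) ℝ) (i : Fin nu)
    (σw σx δ : ℝ) (hσw : 0 ≤ σw) (hσx : 0 < σx) (hδ : δ ∈ Set.Ioo (0 : ℝ) 1)
    (T : ℕ) (hT : nx + 1 ≤ T)
    (x w : Fin T → Ω → EuclideanSpace ℝ (Fin nx))
    (hx_meas : ∀ t, Measurable (x t)) (hw_meas : ∀ t, Measurable (w t))
    (hx_indep : iIndepFun x μ) (hx_ident : ∀ s t, IdentDistrib (x s) (x t) μ μ)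
    (hw_indep : iIndepFun w μ)
    (hw_law : ∀ t, HasLaw (w t) (multivariateGaussian 0 (σw ^ 2 • 1)) μ)
    (hxw_indep : IndepFun (fun ω t => x t ω) (fun ω t => w t ω) μ) :
    ∃ G : Set Ω, MeasurableSet G ∧ 1 - δ / (2 * nu) ≤ μ.real G ∧
      ∀ ω ∈ G, ∀ θhat : Matrix (Fin nx) (Fin nx ⊕ Unit) ℝ,
        BilinearId.IsOLS (fun t => x t ω)
          (fun t => BilinearId.affineStep (B i) (B₀.col i) (x t ω) (w t ω)) θhat →
        BilinearId.LoewnerLEInv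
          (BilinearId.stackedError σx θhat (BilinearId.param (B i) (B₀.col i)) *
            (BilinearId.stackedError σx θhat (BilinearId.param (B i) (B₀.col i)))ᵀ)
          (BilinearId.C₁ σw nx nu δ)
          (BilinearId.dataMatrix_isHermitian σx (fun t => x t ω)) :=
  mainTheorem5_general μ B₀ B i σw σx δ hσw hσx.ne' hδ T x w hx_meas hw_meas hw_indep hw_law
    hxw_indep
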